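/- Let $\mathbf a_1,\mathbf a_2\in\mathbb{R}^2$ be linearly independent, $\mathcal K'=\mathbb Z\mathbf a_1+\mathbb Z\mathbf a_2$, and $Q'=\mathbb{R}^2/\mathcal K'$ the corresponding torus (period cell). Let $\mathcal B'$ be the first Brillouin zone of $\mathcal K'$, i.e. the (closed) Wigner–Seitz cell $\{\xi' : |\xi'|\le|\xi'-g| \text{ for all } g\in\mathcal K'^*\}$ of the reciprocal lattice $\mathcal K'^*=\{g\in\mathbb{R}^2 : g\cdot k\in 2\pi\mathbb Z \text{ for all } k\in\mathcal K'\}$. Consider a non-magnetic medium whose real permittivity $\epsilon=\epsilon(\mathbf x')$, $\mathbf x'=(x,y)$, is invariant in the $z$-direction, $\mathcal K'$-periodic, positive, and satisfies $\epsilon,\epsilon^{-1}\in L^\infty$; let $\epsilon_0>0$ and define the refractive index $n$ by $\epsilon=\epsilon_0 n^2$, $n>0$. For $\xi'=(\xi_1,\xi_2)\in\mathbb{R}^2$ and $\beta\in\mathbb{R}$ put $\nabla'_{(\xi',\beta)}=(\partial_x,\partial_y,0)+i(\xi_1,\xi_2,\beta)$, acting in the sense of distributions on $Q'$. With $\mathbb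 L^2(Q')=L^2(Q';\mathbb C)^3$ and $\mathbb H^1(Q')=H^1(Q';\mathbb C)^3$, normed by $\|\mathbf v\|^2_{\mathbb H^1(Q')}=\|\mathbf v\|^2_{\mathbb L^2(Q')}+\|\partial_x\mathbf v\|^2_{\mathbb L^2(Q')}+\|\partial_y\mathbf v\|^2_{\mathbb L^2(Q')}$, let $$\mathbf V'_{(\xi',\beta)}=\{\mathbf v\in\mathbb L^2(Q') : \nabla'_{(\xi',\beta)}\times\mathbf v\in\mathbb L^2(Q'),\ \nabla'_{(\xi',\beta)}\cdot\mathbf v=0\},$$ $$a'_{(\xi',\beta)}(\mathbf u,\mathbf v)=\int_{Q'}\tfrac1{n^2}\,\nabla'_{(\xi',\beta)}\times\mathbf u\cdot\overline{\nabla'_{(\xi',\beta)}\times\mathbf v}\;dx\,dy .$$ Let $L'_{(\xi',\beta)}=\nabla'_{(\xi',\beta)}\times\big(\tfrac1{n^2}\nabla'_{(\xi',\beta)}\times\,\cdot\,\big)$ be the unbounded operator on the Hilbert space $\{\mathbf v\in\mathbb L^2(Q') : \nabla'_{(\xi',\beta)}\cdot\mathbf v=0\}$ whose domain consists of all $\mathbf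 u\in\mathbf V'_{(\xi',\beta)}$ with $\nabla'_{(\xi',\beta)}\times(\tfrac1{n^2}\nabla'_{(\xi',\beta)}\times\mathbf u)\in\mathbb L^2(Q')$. **Theorem.** For every $\beta\in\mathbb{R}$ and every $\xi'\in\mathcal B'$: 1. $\mathbf V'_{(\xi',\beta)}\subset\mathbb H^1(Q')$. 2. For every $\mathbf v\in\mathbf V'_{(\xi',\beta)}$ the number $a'_{(\xi',\beta)}(\mathbf v,\mathbf v)$ is real, and $$\|n\|^2_{L^\infty(Q')}\,a'_{(\xi',\beta)}(\mathbf v,\mathbf v)+(3|\xi'|^2+1)\|\mathbf v\|^2_{\mathbb L^2(Q')}\ \ge\ \tfrac12\|\mathbf v\|^2_{\mathbb H^1(Q')}+\beta^2\|\mathbf v\|^2_{\mathbb L^2(Q')}.$$ 3. The spectrum of $L'_{(\xi',\beta)}$ is discrete and formed by a sequence of nonnegative eigenvalues: there are real numbers $0\le\lambda_0<\lambda_1<\lambda_2<\cdots$ with $\lambda_m\to\infty$ such that the spectrum is exactly $\{\lambda_m : m\ge0\}$ and every $\lambda_m$ is an eigenvalue of finite multiplicity. -/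

import Mathlib

open MeasureTheory Filter Topology
open scoped ENNReal ContDiff Manifold

noncomputable section

namespace PhotonicCrystal

/-- The plane `ℝ²` of the transverse variables `x' = (x, y)`. -/
abbrev Plane : Type := EuclideanSpace ℝ (Fin 2)

/-- The lattice of all integer combinations of the primitive vectors `b 0`, `b 1`. -/
abbrev lattice (b : Module.Basis (Fin 2) ℝ Plane) : Submodule ℤ Plane :=
  Submodule.span ℤ (Set.range b)

/-- The reciprocal lattice: all `g` such that `g · k ∈ 2πℤ` for every lattice vector `k`. -/
def reciprocalLattice (b : Module.Basis (Fin 2) ℝ Plane) : Set Plane :=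
  {g | ∀ k ∈ lattice b, ∃ m : ℤ, inner ℝ g k = 2 * Real.pi * (m : ℝ)}

/-- The (closed) first Brillouin zone: the Wigner-Seitz cell of the reciprocal lattice, i.e. the
points that are at least as close to the origin as to any other reciprocal lattice point. -/
def brillouinZone (b : Module.Basis (Fin 2) ℝ Plane) : Set Plane :=
  {ξ | ∀ g ∈ reciprocalLattice b, ‖ξ‖ ≤ ‖ξ - g‖}

/-- The period cell `{s b₀ + t b₁ : 0 ≤ s, t < 1}`, which represents the points of the torus
`Q' = ℝ² / lattice`. -/
abbrev cell (b : Module.Basis (Fin 2) ℝ Plane) : Set Plane := ZSpan.fundamentalDomain b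

/-- Lebesgue measure on the torus, carried by the period cell. -/
abbrev cellMeasure (b : Module.Basis (Fin 2) ℝ Plane) : Measure Plane :=
  volume.restrict (cell b)

/-- The scalar space `L²(Q')`. -/
abbrev L2 (b : Module.Basis (Fin 2) ℝ Plane) : Type := Lp ℂ 2 (cellMeasure b)

/-- The space `𝕃²(Q') = L²(Q')³`, with `‖v‖² = ∑ i, ‖v i‖²`. -/
abbrev L2Vec (b : Module.Basis (Fin 2) ℝ Plane) : Type := PiLp 2 (fun _ : Fin 3 => L2 b)

/-- Smooth functions on the torus: smooth functions on the plane, periodic for the lattice. -/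
def IsTest (b : Module.Basis (Fin 2) ℝ Plane) (φ : Plane → ℂ) : Prop :=
  ContDiff ℝ ∞ φ ∧ ∀ k ∈ lattice b, ∀ x, φ (x + k) = φ x

/-- The partial derivative `∂φ/∂x` (for `j = 0`) or `∂φ/∂y` (for `j = 1`). -/
def partialDeriv (j : Fin 2) (φ : Plane → ℂ) (x : Plane) : ℂ :=
  fderiv ℝ φ x (EuclideanSpace.single j 1)

/-- The gradient `(∂/∂x, ∂/∂y, 0)` of a function of the transverse variables. -/
def gradient (φ : Plane → ℂ) (x : Plane) : Fin 3 → ℂ :=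
  ![partialDeriv 0 φ x, partialDeriv 1 φ x, 0]

/-- The vector `(ξ', β)`. -/
def waveVector (ξ : Plane) (β : ℝ) : Fin 3 → ℝ := ![ξ 0, ξ 1, β]

/-- The bilinear pairing `∫_{Q'} u ψ`. -/
def pairing (b : Module.Basis (Fin 2) ℝ Plane) (u : L2 b) (ψ : Plane → ℂ) : ℂ :=
  ∫ x in cell b, u x * ψ x

/-- The transpose `-∂_j + i (ξ', β)_j` of the component `j` of
`∇'_(ξ',β) = (∂/∂x, ∂/∂y, 0) + i (ξ', β)`. -/
def nablaTranspose (ξ : Plane) (β : ℝ) (j : Fin 3) (φ : Plane → ℂ) (x : Plane) : ℂ :=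
  -gradient φ x j + Complex.I * (waveVector ξ β j : ℂ) * φ x

/-- The value on `φ` of the distribution `(∇'_(ξ',β))_j u`, for `u ∈ L²(Q')`. -/
def nablaPairing (b : Module.Basis (Fin 2) ℝ Plane) (ξ : Plane) (β : ℝ) (j : Fin 3) (u : L2 b)
    (φ : Plane → ℂ) : ℂ :=
  pairing b u (nablaTranspose ξ β j φ)

/-- `∇'_(ξ',β) × v = w` in the sense of distributions on `Q'`.  Indices are read modulo `3`. -/
def IsWeakCurl (b : Module.Basis (Fin 2) ℝ Plane) (ξ : Plane) (β : ℝ) (v w : L2Vec b) : Prop :=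
  ∀ φ, IsTest b φ → ∀ i : Fin 3,
    pairing b (w i) φ =
      nablaPairing b ξ β (i + 1) (v (i + 2)) φ - nablaPairing b ξ β (i + 2) (v (i + 1)) φ

/-- `∇'_(ξ',β) · v = 0` in the sense of distributions on `Q'`. -/
def IsDivFree (b : Module.Basis (Fin 2) ℝ Plane) (ξ : Plane) (β : ℝ) (v : L2Vec b) : Prop :=
  ∀ φ, IsTest b φ → ∑ j : Fin 3, nablaPairing b ξ β j (v j) φ = 0

/-- `∂_j u = g` in the sense of distributions on `Q'`. -/
def IsWeakPartial (b : Module.Basis (Fin 2) ℝ Plane) (j : Fin 2) (u g : L2 b) : Prop :=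
  ∀ φ, IsTest b φ → pairing b u (partialDeriv j φ) = -pairing b g φ

/-! ### Elementary facts on the pairing -/

theorem IsTest.continuous {b : Module.Basis (Fin 2) ℝ Plane} {φ : Plane → ℂ} (h : IsTest b φ) :
    Continuous φ := h.1.continuous

theorem IsTest.continuous_partialDeriv {b : Module.Basis (Fin 2) ℝ Plane} {φ : Plane → ℂ}
    (h : IsTest b φ) (j : Fin 2) : Continuous (partialDeriv j φ) :=
  (h.1.continuous_fderiv (by simp)).clm_apply continuous_const

theorem IsTest.continuous_nablaTranspose {b : Module.Basis (Fin 2) ℝ Plane} {φ : Plane → ℂ}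
    (h : IsTest b φ) (ξ : Plane) (β : ℝ) (j : Fin 3) : Continuous (nablaTranspose ξ β j φ) := by
  have h0 := h.continuous
  have h1 := h.continuous_partialDeriv
  have h2 : Continuous fun x => gradient φ x j := by
    fin_cases j
    · exact h1 0
    · exact h1 1
    · exact continuous_const
  unfold nablaTranspose
  fun_prop

theorem integrable_pairing (b : Module.Basis (Fin 2) ℝ Plane) (u : L2 b) {ψ : Plane → ℂ}
    (hψ : Continuous ψ) : Integrable (fun x => u x * ψ x) (cellMeasure b) := by
  have hb : Bornology.IsBounded (cell b) := ZSpan.fundamentalDomain_isBounded b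
  have : IsFiniteMeasure (cellMeasure b) := ⟨by
    rw [Measure.restrict_apply_univ]
    exact hb.measure_lt_top⟩
  have hu : Integrable u (cellMeasure b) := (Lp.memLp u).integrable (by norm_num)
  obtain ⟨C, hC⟩ := hb.isCompact_closure.exists_bound_of_continuousOn hψ.continuousOn
  refine hu.mul_bdd (c := C) hψ.aestronglyMeasurable ?_
  refine (ae_restrict_iff' (ZSpan.fundamentalDomain_measurableSet b)).2 (Eventually.of_forall ?_)
  exact fun x hx => hC x (subset_closure hx)

theorem pairing_add (b : Module.Basis (Fin 2) ℝ Plane) (u v : L2 b) {ψ : Plane → ℂ}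
    (hψ : Continuous ψ) : pairing b (u + v) ψ = pairing b u ψ + pairing b v ψ := by
  unfold pairing
  rw [← integral_add (integrable_pairing b u hψ) (integrable_pairing b v hψ)]
  refine integral_congr_ae ?_
  filter_upwards [Lp.coeFn_add u v] with x hx
  rw [hx, Pi.add_apply, add_mul]

theorem pairing_smul (b : Module.Basis (Fin 2) ℝ Plane) (c : ℂ) (u : L2 b) (ψ : Plane → ℂ) :
    pairing b (c • u) ψ = c * pairing b u ψ := by
  unfold pairing
  rw [← integral_const_mul]
  refine integral_congr_ae ?_
  filter_upwards [Lp.coeFn_smul c u] with x hx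
  rw [hx, Pi.smul_apply, smul_eq_mul, mul_assoc]

theorem pairing_zero (b : Module.Basis (Fin 2) ℝ Plane) (ψ : Plane → ℂ) :
    pairing b 0 ψ = 0 := by
  simpa using pairing_smul b 0 0 ψ

/-- The periodization of a smooth function supported inside the period cell. -/
theorem exists_isTest_eqOn (b : Module.Basis (Fin 2) ℝ Plane) {g : Plane → ℝ}
    (hg : ContDiff ℝ ∞ g) (hsupp : HasCompactSupport g) (hsub : tsupport g ⊆ interior (cell b)) :
    ∃ φ, IsTest b φ ∧ ∀ x ∈ cell b, φ x = (g x : ℂ) := by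
  refine ⟨fun x => ∑ᶠ k : lattice b, (g (x + k) : ℂ), ⟨?_, ?_⟩, ?_⟩
  · rw [← contMDiff_iff_contDiff]
    refine contMDiff_finsum (fun k => ?_) ?_
    · rw [contMDiff_iff_contDiff]
      exact Complex.ofRealCLM.contDiff.comp (hg.comp (contDiff_id.add contDiff_const))
    · intro x
      refine ⟨Metric.ball x 1, Metric.ball_mem_nhds x one_pos, ?_⟩
      obtain ⟨R, hR⟩ := hsupp.isCompact.isBounded.exists_norm_le
      have hfin := ZSpan.setFinite_inter b (Metric.isBounded_closedBall (x := (0 : Plane))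
        (r := R + (‖x‖ + 1)))
      refine Set.Finite.of_finite_image (f := fun k : lattice b => (k : Plane))
        (hfin.subset ?_) Subtype.val_injective.injOn
      rintro _ ⟨k, ⟨y, hy1, hy2⟩, rfl⟩
      refine ⟨?_, k.2⟩
      have h1 : g (y + k) ≠ 0 := by
        intro h0
        exact hy1 (by simp [h0])
      have h2 : ‖y + k‖ ≤ R := hR _ (subset_tsupport _ h1)
      have h3 : ‖y‖ ≤ ‖x‖ + 1 := by
        have := norm_le_norm_add_norm_sub' y x
        have h4 := mem_ball_iff_norm.1 hy2
        linarith
      rw [mem_closedBall_zero_iff]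
      have h5 : ‖(k : Plane)‖ ≤ ‖y + k‖ + ‖y‖ := by
        simpa using norm_sub_le (y + (k : Plane)) y
      change ‖(k : Plane)‖ ≤ _
      linarith
  · intro k hk x
    have := finsum_comp_equiv (Equiv.addLeft (⟨k, hk⟩ : lattice b))
      (f := fun l : lattice b => (g (x + l) : ℂ))
    simp only [← this]
    refine finsum_congr fun l => ?_
    simp [add_assoc]
  · intro x hx
    change ∑ᶠ k : lattice b, (g (x + k) : ℂ) = (g x : ℂ)
    rw [finsum_eq_single _ (0 : lattice b)]
    · simp
    · intro k hk
      by_contra h0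
      have h1 : g (x + k) ≠ 0 := fun h => h0 (by simp [h])
      have h2 : x + k ∈ cell b := interior_subset (hsub (subset_tsupport _ h1))
      have e1 := ZSpan.fract_eq_self.2 h2
      rw [ZSpan.fract_add_ZSpan b x k.2, ZSpan.fract_eq_self.2 hx] at e1
      exact hk (Subtype.ext (by simpa using e1.symm))

/-- Elements of `L²(Q')` are determined by their pairings with smooth functions, so weak
derivatives and weak curls are unique. -/
theorem eq_zero_of_pairing (b : Module.Basis (Fin 2) ℝ Plane) {u : L2 b}
    (h : ∀ φ, IsTest b φ → pairing b u φ = 0) : u = 0 := by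
  have hconv : Convex ℝ (cell b) := by
    intro x hx y hy s t hs ht hst i
    have h1 := hx i
    have h2 := hy i
    have := convex_Ico (0 : ℝ) 1 h1 h2 hs ht hst
    simpa using this
  have hmeas : MeasurableSet (cell b) := ZSpan.fundamentalDomain_measurableSet b
  have hint : IntegrableOn u (cell b) := by
    have h1 := integrable_pairing b u (ψ := fun _ => 1) continuous_const
    simp only [mul_one] at h1
    exact h1
  have key := isOpen_interior.ae_eq_zero_of_integral_contDiff_smul_eq_zero (μ := volume)
    (U := interior (cell b)) (f := u)
    (hint.mono_set interior_subset).locallyIntegrableOn ?_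
  · have hfr : volume (frontier (cell b)) = 0 := hconv.addHaar_frontier volume
    refine Lp.ext ?_
    have h0 : ∀ᵐ x, x ∈ cell b → u x = 0 := by
      filter_upwards [key, compl_mem_ae_iff.2 hfr] with x hx1 hx2 hx3
      refine hx1 ?_
      by_contra hx4
      exact hx2 ⟨subset_closure hx3, hx4⟩
    filter_upwards [(ae_restrict_iff' hmeas).2 h0, Lp.coeFn_zero ℂ 2 (cellMeasure b)]
      with x e1 e2
    rw [e1, e2, Pi.zero_apply]
  · intro g hg1 hg2 hg3
    obtain ⟨φ, hφ, hφg⟩ := exists_isTest_eqOn b hg1 hg2 hg3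
    have h1 := h φ hφ
    unfold pairing at h1
    rw [← h1, ← setIntegral_eq_integral_of_forall_compl_eq_zero (s := cell b)]
    · refine setIntegral_congr_fun hmeas fun x hx => ?_
      simp only [hφg x hx, Complex.real_smul, mul_comm]
    · intro x hx
      have : g x = 0 := by
        by_contra h0
        exact hx (interior_subset (hg3 (subset_tsupport _ h0)))
      rw [this, zero_smul]

theorem IsWeakCurl.add {b : Module.Basis (Fin 2) ℝ Plane} {ξ : Plane} {β : ℝ}
    {v w v' w' : L2Vec b} (h : IsWeakCurl b ξ β v w) (h' : IsWeakCurl b ξ β v' w') :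
    IsWeakCurl b ξ β (v + v') (w + w') := by
  intro φ hφ i
  simp only [nablaPairing, PiLp.add_apply, pairing_add b _ _ hφ.continuous,
    pairing_add b _ _ (hφ.continuous_nablaTranspose ξ β _)]
  have h1 := h φ hφ i
  have h2 := h' φ hφ i
  simp only [nablaPairing] at h1 h2
  rw [h1, h2]
  ring

theorem IsWeakCurl.smul {b : Module.Basis (Fin 2) ℝ Plane} {ξ : Plane} {β : ℝ}
    {v w : L2Vec b} (c : ℂ) (h : IsWeakCurl b ξ β v w) :
    IsWeakCurl b ξ β (c • v) (c • w) := by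
  intro φ hφ i
  have h1 := h φ hφ i
  simp only [nablaPairing] at h1 ⊢
  simp only [PiLp.smul_apply, pairing_smul, h1]
  ring

theorem isWeakCurl_zero (b : Module.Basis (Fin 2) ℝ Plane) (ξ : Plane) (β : ℝ) :
    IsWeakCurl b ξ β 0 0 := by
  intro φ _ i
  simp [nablaPairing, pairing_zero]

theorem IsWeakCurl.unique {b : Module.Basis (Fin 2) ℝ Plane} {ξ : Plane} {β : ℝ}
    {v w w' : L2Vec b} (h : IsWeakCurl b ξ β v w) (h' : IsWeakCurl b ξ β v w') : w = w' := by
  ext1 i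
  refine sub_eq_zero.1 (eq_zero_of_pairing b fun φ hφ => ?_)
  have e : w i - w' i = w i + (-1 : ℂ) • w' i := by rw [neg_one_smul, sub_eq_add_neg]
  rw [e, pairing_add b _ _ hφ.continuous, pairing_smul, h φ hφ i, h' φ hφ i]
  ring

/-! ### The function spaces -/

/-- The closed subspace of `𝕃²(Q')` of all fields with `∇'_(ξ',β) · v = 0`. -/
def divFree (b : Module.Basis (Fin 2) ℝ Plane) (ξ : Plane) (β : ℝ) : Submodule ℂ (L2Vec b) where
  carrier := {v | IsDivFree b ξ β v}
  zero_mem' := fun φ _ => by simp [nablaPairing, pairing_zero]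
  add_mem' := fun {u v} hu hv φ hφ => by
    have h1 := hu φ hφ
    have h2 := hv φ hφ
    simp only [nablaPairing] at h1 h2 ⊢
    simp only [PiLp.add_apply, pairing_add b _ _ (hφ.continuous_nablaTranspose ξ β _),
      Finset.sum_add_distrib, h1, h2, add_zero]
  smul_mem' := fun c v hv φ hφ => by
    have h1 := hv φ hφ
    simp only [nablaPairing] at h1 ⊢
    simp only [PiLp.smul_apply, pairing_smul, ← Finset.mul_sum, h1, mul_zero]

/-- The variational space
`V'_(ξ',β) = {v ∈ 𝕃²(Q') : ∇'_(ξ',β) × v ∈ 𝕃²(Q'), ∇'_(ξ',β) · v = 0}`. -/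
def variationalSpace (b : Module.Basis (Fin 2) ℝ Plane) (ξ : Plane) (β : ℝ) :
    Submodule ℂ (L2Vec b) where
  carrier := {v | (∃ w, IsWeakCurl b ξ β v w) ∧ IsDivFree b ξ β v}
  zero_mem' := ⟨⟨0, isWeakCurl_zero b ξ β⟩, (divFree b ξ β).zero_mem⟩
  add_mem' := fun ⟨⟨w, hw⟩, hu⟩ ⟨⟨w', hw'⟩, hv⟩ =>
    ⟨⟨w + w', hw.add hw'⟩, (divFree b ξ β).add_mem hu hv⟩
  smul_mem' := fun c _ ⟨⟨w, hw⟩, hv⟩ => ⟨⟨c • w, hw.smul c⟩, (divFree b ξ β).smul_mem c hv⟩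

/-- The Sobolev space `ℍ¹(Q')`: all fields in `𝕃²(Q')` whose components have both weak first
derivatives in `L²(Q')`. -/
def sobolevH1 (b : Module.Basis (Fin 2) ℝ Plane) : Submodule ℂ (L2Vec b) where
  carrier := {v | ∀ (i : Fin 3) (j : Fin 2), ∃ g, IsWeakPartial b j (v i) g}
  zero_mem' := fun i j => ⟨0, fun φ _ => by simp [pairing_zero]⟩
  add_mem' := fun {u v} hu hv i j => by
    obtain ⟨g, hg⟩ := hu i j
    obtain ⟨g', hg'⟩ := hv i j
    refine ⟨g + g', fun φ hφ => ?_⟩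
    rw [PiLp.add_apply, pairing_add b _ _ (hφ.continuous_partialDeriv j),
      pairing_add b _ _ hφ.continuous, hg φ hφ, hg' φ hφ]
    ring
  smul_mem' := fun c v hv i j => by
    obtain ⟨g, hg⟩ := hv i j
    refine ⟨c • g, fun φ hφ => ?_⟩
    rw [PiLp.smul_apply, pairing_smul, pairing_smul, hg φ hφ]
    ring

open Classical in
/-- The weak derivative `∂_j u ∈ L²(Q')` (zero if there is none). -/
def weakPartial (b : Module.Basis (Fin 2) ℝ Plane) (j : Fin 2) (u : L2 b) : L2 b :=
  if h : ∃ g, IsWeakPartial b j u g then h.choose else 0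

/-- The norm of `ℍ¹(Q')`: `‖v‖² + ∑ i, ∑ j, ‖∂_j v_i‖²` is its square. -/
def h1Norm (b : Module.Basis (Fin 2) ℝ Plane) (v : L2Vec b) : ℝ :=
  Real.sqrt (‖v‖ ^ 2 + ∑ i : Fin 3, ∑ j : Fin 2, ‖weakPartial b j (v i)‖ ^ 2)

open Classical in
/-- The weak curl `∇'_(ξ',β) × v ∈ 𝕃²(Q')` (zero if there is none). -/
def curl (b : Module.Basis (Fin 2) ℝ Plane) (ξ : Plane) (β : ℝ) (v : L2Vec b) : L2Vec b :=
  if h : ∃ w, IsWeakCurl b ξ β v w then h.choose else 0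

/-! ### The sesquilinear form and the operator -/

/-- The refractive index `n`, given by `ε = ε₀ n²`. -/
def refractiveIndex (ε₀ : ℝ) (ε : Plane → ℝ) (x : Plane) : ℝ := Real.sqrt (ε x / ε₀)

/-- The norm of `n` in `L^∞(Q')`. -/
def indexSupNorm (b : Module.Basis (Fin 2) ℝ Plane) (n : Plane → ℝ) : ℝ :=
  (eLpNorm n ⊤ (cellMeasure b)).toReal

/-- The form `a'(u, v) = ∫_{Q'} n⁻² (∇'_(ξ',β) × u) · conj (∇'_(ξ',β) × v)`. -/
def form (b : Module.Basis (Fin 2) ℝ Plane) (n : Plane → ℝ) (ξ : Plane) (β : ℝ)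
    (u v : L2Vec b) : ℂ :=
  ∫ x in cell b, ((1 / n x ^ 2 : ℝ) : ℂ) *
    ∑ i : Fin 3, curl b ξ β u i x * starRingEnd ℂ (curl b ξ β v i x)

/-- The graph of `L'_(ξ',β) = ∇'_(ξ',β) × (n⁻² ∇'_(ξ',β) × ·)` in the Hilbert space of
divergence-free fields: the pairs `(u, f)` with `u` in the variational space and
`∇'_(ξ',β) × (n⁻² ∇'_(ξ',β) × u) = f` in the sense of distributions. -/
def maxwellGraph (b : Module.Basis (Fin 2) ℝ Plane) (n : Plane → ℝ) (ξ : Plane) (β : ℝ) :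
    Submodule ℂ (divFree b ξ β × divFree b ξ β) where
  carrier := {p | ∃ w g : L2Vec b, IsWeakCurl b ξ β p.1 w ∧
    (∀ i, g i =ᵐ[cellMeasure b] fun x => ((1 / n x ^ 2 : ℝ) : ℂ) * w i x) ∧
    IsWeakCurl b ξ β g p.2}
  zero_mem' := by
    refine ⟨0, 0, isWeakCurl_zero b ξ β, fun i => ?_, isWeakCurl_zero b ξ β⟩
    filter_upwards [Lp.coeFn_zero ℂ 2 (cellMeasure b)] with x hx
    change (0 : Lp ℂ 2 (cellMeasure b)) x = _ * (0 : Lp ℂ 2 (cellMeasure b)) x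
    rw [hx]
    simp
  add_mem' := by
    rintro p q ⟨w, g, h1, h2, h3⟩ ⟨w', g', h1', h2', h3'⟩
    refine ⟨w + w', g + g', h1.add h1', fun i => ?_, h3.add h3'⟩
    filter_upwards [h2 i, h2' i, Lp.coeFn_add (w i) (w' i), Lp.coeFn_add (g i) (g' i)]
      with x e1 e2 e3 e4
    rw [PiLp.add_apply, PiLp.add_apply, e3, e4, Pi.add_apply, Pi.add_apply, e1, e2, mul_add]
  smul_mem' := by
    rintro c p ⟨w, g, h1, h2, h3⟩
    refine ⟨c • w, c • g, h1.smul c, fun i => ?_, h3.smul c⟩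
    filter_upwards [h2 i, Lp.coeFn_smul c (w i), Lp.coeFn_smul c (g i)] with x e1 e2 e3
    rw [PiLp.smul_apply, PiLp.smul_apply, e2, e3, Pi.smul_apply, Pi.smul_apply, e1, smul_eq_mul,
      smul_eq_mul, mul_left_comm]

/-- The relation `maxwellGraph` is single-valued, so that it is the graph of an operator. -/
theorem maxwellGraph_snd_eq_zero (b : Module.Basis (Fin 2) ℝ Plane) (n : Plane → ℝ) (ξ : Plane)
    (β : ℝ) : ∀ p ∈ maxwellGraph b n ξ β, p.1 = 0 → p.2 = 0 := by
  rintro ⟨u, f⟩ ⟨w, g, h1, h2, h3⟩ hu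
  simp only at hu h1 h3
  subst hu
  have hw : w = 0 := h1.unique (isWeakCurl_zero b ξ β)
  subst hw
  have hg : g = 0 := by
    ext1 i
    refine Lp.ext ?_
    filter_upwards [h2 i, Lp.coeFn_zero ℂ 2 (cellMeasure b)] with x e1 e2
    rw [e1, PiLp.zero_apply, e2]
    simp
  subst hg
  exact Subtype.ext (h3.unique (isWeakCurl_zero b ξ β))

/-- The unbounded operator `L'_(ξ',β) = ∇'_(ξ',β) × (n⁻² ∇'_(ξ',β) × ·)` on the Hilbert space of
divergence-free fields, with graph `maxwellGraph`. -/
def maxwellOperator (b : Module.Basis (Fin 2) ℝ Plane) (n : Plane → ℝ) (ξ : Plane) (β : ℝ) :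
    divFree b ξ β →ₗ.[ℂ] divFree b ξ β :=
  (maxwellGraph b n ξ β).toLinearPMap

theorem maxwellOperator_graph (b : Module.Basis (Fin 2) ℝ Plane) (n : Plane → ℝ) (ξ : Plane)
    (β : ℝ) : (maxwellOperator b n ξ β).graph = maxwellGraph b n ξ β :=
  Submodule.toLinearPMap_graph_eq _ (maxwellGraph_snd_eq_zero b n ξ β)

/-! ### Spectra of unbounded operators -/

/-- The spectrum of an unbounded operator `T`: all `z` for which `z - T : D(T) → E` has no
everywhere defined bounded inverse `R`. -/
def unboundedSpectrum {E : Type*} [NormedAddCommGroup E] [NormedSpace ℂ E]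
    (T : E →ₗ.[ℂ] E) : Set ℂ :=
  {z | ¬ ∃ R : E →L[ℂ] E,
    (∀ u : T.domain, R (z • (u : E) - T u) = u) ∧
    ∀ f : E, ∃ h : R f ∈ T.domain, z • R f - T ⟨R f, h⟩ = f}

/-- The eigenspace `{u ∈ D(T) : T u = z u}` of an unbounded operator `T`. -/
def unboundedEigenspace {E : Type*} [NormedAddCommGroup E] [NormedSpace ℂ E]
    (T : E →ₗ.[ℂ] E) (z : ℂ) : Submodule ℂ T.domain :=
  LinearMap.ker (T.toFun - z • T.domain.subtype)

end PhotonicCrystal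

end

noncomputable section

namespace PhotonicCrystal

/-! ### Operators with compact resolvent -/

/-! Everything happens on the Fourier side. On the plane wave of reciprocal lattice vector `g`, `∇'`
acts as multiplication by `i k` with `k = (ξ' + g, β)`, so curl and divergence become `i k ×` and `i
k ·` (`isWeakCurl_iff`, `isDivFree_iff`). For a divergence-free field the amplitude `z` is
orthogonal to `k`, and Lagrange's identity gives `|k × z|² = (|ξ' + g|² + β²)|z|²`
(`sum_norm_coeff_curl_sq`). Since `|g|² ≤ 2|ξ' + g|² + 2|ξ'|²`, the curl controls all first
derivatives. Summing over `g` yields the inclusion in `ℍ¹` and, with `1 ≤ ‖n‖²_∞ / n²` almost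
everywhere, the coercivity estimate (`h1Norm_sq_le`, `norm_curl_sq_le_form`).

For the spectrum, let `A = n⁻¹ ∇' ×` on the Hilbert space of divergence-free fields. Its graph is
closed and its domain is dense. The Maxwell operator is `A†A` (`mem_maxwellGraph_iff`): one
direction is the symmetry of the curl, the other tests with divergence-free plane waves only. If `J`
is the projection of the graph of `A`, with its Hilbert norm, to the first factor, then `T = J J†`
is `(1 + A†A)⁻¹`. The Fourier estimate also shows that discarding the frequencies above `R` costs
`O(1/R)` in the graph norm, so `J`, and with it `T`, is compact (`norm_sub_lowModes_sq_le`,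
`isCompactOperator_of_approx`). The spectral theorem for compact self-adjoint operators, applied to
the injective positive contraction `T`, then transfers to `T⁻¹ - 1`
(`exists_eigenvalues_of_compact_resolvent`). -/

/-- An infinite set of reals that is finite below every bound is the range of a strictly increasing
sequence tending to infinity. -/
theorem exists_strictMono_range_eq {S : Set ℝ} (hinf : S.Infinite)
    (hfin : ∀ B : ℝ, (S ∩ Set.Iic B).Finite) :
    ∃ f : ℕ → ℝ, StrictMono f ∧ Tendsto f atTop atTop ∧ Set.range f = S := by
  have hS : Nonempty S := hinf.nonempty.to_subtype
  have : Infinite S := hinf.to_subtype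
  -- With finite intervals, a least element and no greatest one, `S` is order isomorphic to `ℕ`.
  let _ : LocallyFiniteOrder S := LocallyFiniteOrder.ofFiniteIcc fun a c => by
    refine Set.Finite.of_finite_image (f := Subtype.val) ((hfin c).subset ?_)
      Subtype.val_injective.injOn
    rintro _ ⟨x, hx, rfl⟩
    exact ⟨x.2, hx.2⟩
  obtain ⟨s₀, hs₀⟩ := hinf.nonempty
  obtain ⟨m, hm, hmin⟩ := (hfin s₀).exists_minimal ⟨s₀, hs₀, Set.mem_Iic.2 le_rfl⟩
  have hbot : ∀ x ∈ S, m ≤ x := by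
    intro x hx
    by_contra! h
    exact absurd (hmin ⟨hx, h.le.trans hm.2⟩ h.le) (not_le.2 h)
  let _ : OrderBot S := { bot := ⟨m, hm.1⟩, bot_le := fun x => hbot x x.2 }
  have : NoMaxOrder S := ⟨fun a => by
    by_contra! h
    exact hinf ((hfin a).subset fun x hx => ⟨hx, h ⟨x, hx⟩⟩)⟩
  let _ : SuccOrder S := LinearLocallyFiniteOrder.succOrder S
  let _ : PredOrder S := LinearLocallyFiniteOrder.predOrder S
  let e : S ≃o ℕ := orderIsoNatOfLinearSuccPredArch
  have hmono : StrictMono fun k => (e.symm k : ℝ) := fun a c h => e.symm.strictMono h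
  have hrange : Set.range (fun k => (e.symm k : ℝ)) = S := by
    ext x
    constructor
    · rintro ⟨k, rfl⟩
      exact (e.symm k).2
    · intro hx
      exact ⟨e ⟨x, hx⟩, by simp⟩
  refine ⟨_, hmono, tendsto_atTop_atTop_of_monotone hmono.monotone fun B => ?_, hrange⟩
  by_contra! h
  refine hinf ((hfin B).subset fun x hx => ⟨hx, ?_⟩)
  rw [← hrange] at hx
  obtain ⟨k, rfl⟩ := hx
  exact (h k).le

open Module.End

section CompactResolvent

variable {E : Type*} [NormedAddCommGroup E] [InnerProductSpace ℂ E]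

/-- Symmetry makes `μ` real, positivity and injectivity make it positive, and contractivity bounds
it by 1. Hence `μ = 1 / (1 + t)` with `t ≥ 0`, and this `t` is the eigenvalue of `T⁻¹ - 1`. -/
theorem exists_real_of_hasEigenvalue {T : E →L[ℂ] E} (hs : T.IsSymmetric)
    (hinj : Function.Injective T) (hpos : ∀ x, 0 ≤ RCLike.re (inner ℂ x (T x)))
    (hcontr : ∀ x, ‖T x‖ ≤ ‖x‖) {μ : ℂ} (hμ : HasEigenvalue (T : Module.End ℂ E) μ) :
    ∃ r : ℝ, 0 < r ∧ r ≤ 1 ∧ μ = r := by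
  have hreal : μ = (μ.re : ℂ) := (Complex.conj_eq_iff_re.1 (hs.conj_eigenvalue_eq_self hμ)).symm
  obtain ⟨v, hv, hv0⟩ := hμ.exists_hasEigenvector
  have hTv : T v = μ • v := mem_eigenspace_iff.1 hv
  have hnn : 0 ≤ μ.re := eigenvalue_nonneg_of_nonneg (T := (T : E →ₗ[ℂ] E)) (hreal ▸ hμ) hpos
  refine ⟨μ.re, lt_of_le_of_ne hnn fun h => hv0 (hinj ?_), ?_, hreal⟩
  · rw [hTv, hreal, ← h]
    simp
  · have h1 := hcontr v
    rw [hTv, norm_smul] at h1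
    have h2 : ‖μ‖ ≤ 1 := (mul_le_iff_le_one_left (norm_pos_iff.2 hv0)).1 h1
    exact (Complex.re_le_norm μ).trans h2

/-- Infinitely many such eigenvalues would have orthonormal eigenvectors whose images are pairwise
at distance at least `δ`, whereas compactness forces a convergent subsequence of the images. -/
theorem finite_setOf_hasEigenvalue_ge {T : E →L[ℂ] E} (hc : IsCompactOperator T)
    (hs : T.IsSymmetric) {δ : ℝ} (hδ : 0 < δ) :
    {r : ℝ | δ ≤ r ∧ HasEigenvalue (T : Module.End ℂ E) (r : ℂ)}.Finite := by
  by_contra hinf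
  set f := Set.Infinite.natEmbedding _ hinf
  have hex : ∀ k, ∃ v : E, ‖v‖ = 1 ∧ T v = ((f k : ℝ) : ℂ) • v := by
    intro k
    obtain ⟨v, hv, hv0⟩ := (f k).2.2.exists_hasEigenvector
    have hv' : T v = ((f k : ℝ) : ℂ) • v := mem_eigenspace_iff.1 hv
    refine ⟨((‖v‖⁻¹ : ℝ) : ℂ) • v, ?_, ?_⟩
    · rw [norm_smul, Complex.norm_real, norm_inv, norm_norm,
        inv_mul_cancel₀ (norm_ne_zero_iff.2 hv0)]
    · rw [map_smul, hv', smul_comm]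
  choose e he1 he2 using hex
  have horth : ∀ k l, k ≠ l → inner ℂ (e k) (e l) = 0 := by
    intro k l hkl
    have hne : ((f k : ℝ) : ℂ) ≠ ((f l : ℝ) : ℂ) := fun h =>
      hkl (f.injective (Subtype.ext (Complex.ofReal_injective h)))
    exact hs.orthogonalFamily_eigenspaces hne
      ⟨e k, mem_eigenspace_iff.2 (he2 k)⟩ ⟨e l, mem_eigenspace_iff.2 (he2 l)⟩
  have hfar : ∀ k l, k ≠ l → δ ≤ ‖T (e k) - T (e l)‖ := by
    intro k l hkl
    have h1 : ‖T (e k) - T (e l)‖ ^ 2 = (f k : ℝ) ^ 2 + (f l : ℝ) ^ 2 := by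
      rw [@norm_sub_sq ℂ, he2, he2, inner_smul_left, inner_smul_right, horth k l hkl]
      simp [norm_smul, he1]
    have h2 : δ ≤ f k := (f k).2.1
    refine le_of_sq_le_sq ?_ (norm_nonneg _)
    rw [h1]
    nlinarith [sq_nonneg (f l : ℝ)]
  obtain ⟨K, hK, hK'⟩ := hc.image_closedBall_subset_compact 1
  obtain ⟨y, -, ψ, hψ, hψy⟩ := hK.tendsto_subseq (x := fun k => T (e k))
    (fun k => hK' ⟨e k, by simp [he1], rfl⟩)
  obtain ⟨N, hN⟩ := Metric.cauchySeq_iff'.1 hψy.cauchySeq δ hδ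
  have h3 := hN (N + 1) (Nat.le_succ N)
  rw [dist_eq_norm] at h3
  exact absurd h3 (not_lt.2 (hfar _ _ (hψ.injective.ne (Nat.succ_ne_self N))))

variable [CompleteSpace E]

/-- The eigenspaces have trivial common orthogonal complement. Were there finitely many nonzero
ones, each of finite dimension since `0` is not an eigenvalue, their sum would be
finite-dimensional, hence closed, hence all of `E`. -/
theorem infinite_setOf_hasEigenvalue {T : E →L[ℂ] E} (hE : ¬ FiniteDimensional ℂ E)
    (hc : IsCompactOperator T) (hs : T.IsSymmetric) (hinj : Function.Injective T) :
    {μ : ℂ | HasEigenvalue (T : Module.End ℂ E) μ}.Infinite := by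
  intro hfin
  set F := {μ : ℂ | HasEigenvalue (T : Module.End ℂ E) μ}
  have : Finite F := hfin
  have h0 : (0 : ℂ) ∉ F := by
    intro h
    obtain ⟨v, hv, hv0⟩ := HasEigenvalue.exists_hasEigenvector h
    have h1 : T v = (0 : ℂ) • v := mem_eigenspace_iff.1 hv
    exact hv0 (hinj (by simp [h1]))
  have hfd : ∀ μ : F, FiniteDimensional ℂ (eigenspace (T : Module.End ℂ E) (μ : ℂ)) :=
    fun μ => T.finite_dimensional_eigenspace hc μ (fun h => h0 (h ▸ μ.2))
  have hsup : (⨆ μ, eigenspace (T : Module.End ℂ E) μ) =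
      ⨆ μ : F, eigenspace (T : Module.End ℂ E) (μ : ℂ) := by
    refine le_antisymm (iSup_le fun μ => ?_) (iSup_le fun μ => le_iSup _ (μ : ℂ))
    by_cases hμ : HasEigenvalue (T : Module.End ℂ E) μ
    · exact le_iSup (fun μ : F => eigenspace (T : Module.End ℂ E) (μ : ℂ)) ⟨μ, hμ⟩
    · have : eigenspace (T : Module.End ℂ E) μ = ⊥ := by
        by_contra h
        exact hμ (hasEigenvalue_iff.2 h)
      rw [this]
      exact bot_le
  have hbot := T.orthogonalComplement_iSup_eigenspaces_eq_bot hc hs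
  rw [hsup] at hbot
  have hfd' : FiniteDimensional ℂ (⨆ μ : F, eigenspace (T : Module.End ℂ E) (μ : ℂ) :
      Submodule ℂ E) := Submodule.finiteDimensional_iSup _
  rw [Submodule.orthogonal_eq_bot_iff] at hbot
  rw [hbot] at hfd'
  exact hE (LinearEquiv.finiteDimensional Submodule.topEquiv)

/-- An operator whose graph is that of `T⁻¹ - 1`, for an injective compact self-adjoint
contraction `T ≥ 0` on a Hilbert space of infinite dimension, has discrete spectrum. -/
theorem exists_eigenvalues_of_compact_resolvent {T : E →L[ℂ] E} (hE : ¬ FiniteDimensional ℂ E)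
    (hc : IsCompactOperator T) (hs : T.IsSymmetric) (hinj : Function.Injective T)
    (hpos : ∀ x, 0 ≤ RCLike.re (inner ℂ x (T x))) (hcontr : ∀ x, ‖T x‖ ≤ ‖x‖)
    (L : E →ₗ.[ℂ] E) (hL : ∀ u f, (u, f) ∈ L.graph ↔ u = T (u + f)) :
    ∃ eig : ℕ → ℝ, StrictMono eig ∧ (∀ m, 0 ≤ eig m) ∧ Tendsto eig atTop atTop ∧
      unboundedSpectrum L = Set.range (fun m => (eig m : ℂ)) ∧
      ∀ m, unboundedEigenspace L (eig m : ℂ) ≠ ⊥ ∧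
        FiniteDimensional ℂ (unboundedEigenspace L (eig m : ℂ)) := by
  have hdom : ∀ u f, u = T (u + f) → ∃ h : u ∈ L.domain, L ⟨u, h⟩ = f := by
    intro u f h
    obtain ⟨y, hy1, hy2⟩ := L.mem_graph_iff.1 ((hL u f).2 h)
    simp only at hy1 hy2
    subst hy1
    exact ⟨y.2, hy2⟩
  have hval : ∀ u : L.domain, (u : E) = T (u + L u) := fun u => (hL _ _).1 (L.mem_graph u)
  -- Eigenvectors correspond under `λ ↦ 1 / (1 + λ)`, the map taking `T⁻¹ - 1` to `T`.
  have heigvec : ∀ (t : ℝ), 0 ≤ t → ∀ u : E, T u = ((1 + t : ℝ) : ℂ)⁻¹ • u ↔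
      ∃ h : u ∈ L.domain, L ⟨u, h⟩ = (t : ℂ) • u := by
    intro t ht u
    have ht' : ((1 + t : ℝ) : ℂ) ≠ 0 := by
      rw [Complex.ofReal_ne_zero]
      positivity
    have key : T (u + (t : ℂ) • u) = ((1 + t : ℝ) : ℂ) • T u := by
      rw [map_add, map_smul, Complex.ofReal_add, add_smul, Complex.ofReal_one, one_smul]
    constructor
    · intro h
      apply hdom
      rw [key, h, smul_inv_smul₀ ht']
    · rintro ⟨h, h'⟩
      have h1 := hval ⟨u, h⟩
      rw [h'] at h1
      simp only at h1
      rw [key] at h1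
      rw [eq_inv_smul_iff₀ ht', ← h1]
  set S : Set ℝ := {t | 0 ≤ t ∧ HasEigenvalue (T : Module.End ℂ E) ((1 + t : ℝ) : ℂ)⁻¹}
  have hSinf : S.Infinite := by
    intro hfin
    refine infinite_setOf_hasEigenvalue hE hc hs hinj
      ((hfin.image fun t : ℝ => ((1 + t : ℝ) : ℂ)⁻¹).subset ?_)
    intro μ hμ
    obtain ⟨r, hr0, hr1, rfl⟩ := exists_real_of_hasEigenvalue hs hinj hpos hcontr hμ
    have e : ((1 + (r⁻¹ - 1) : ℝ) : ℂ)⁻¹ = r := by simp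
    refine ⟨r⁻¹ - 1, ⟨sub_nonneg.2 ((one_le_inv₀ hr0).2 hr1), ?_⟩, e⟩
    rw [e]
    exact hμ
  have hSfin : ∀ B : ℝ, (S ∩ Set.Iic B).Finite := by
    intro B
    by_cases hB : 0 ≤ B
    · have hfin := finite_setOf_hasEigenvalue_ge hc hs (δ := (1 + B)⁻¹) (by positivity)
      refine Set.Finite.of_finite_image (f := fun t : ℝ => (1 + t)⁻¹) (hfin.subset ?_) ?_
      · rintro _ ⟨t, ⟨⟨ht0, ht1⟩, ht2⟩, rfl⟩
        have ht2' : t ≤ B := ht2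
        refine ⟨?_, ?_⟩
        · apply inv_anti₀ <;> linarith
        · simpa using ht1
      · intro s _ t _ h
        simpa using h
    · refine Set.finite_empty.subset ?_
      rintro t ⟨⟨ht0, -⟩, ht2⟩
      exact hB (ht0.trans ht2)
  obtain ⟨eig, hmono, htend, hrange⟩ := exists_strictMono_range_eq hSinf hSfin
  have hmem : ∀ m, eig m ∈ S := fun m => hrange ▸ Set.mem_range_self m
  refine ⟨eig, hmono, fun m => (hmem m).1, htend, ?_, fun m => ?_⟩
  · ext z
    constructor
    · intro hz
      by_contra hz'
      apply hz
      -- At `z = -1` the number `(1 + z)⁻¹` is meaningless, but there `z - L = -T⁻¹`, so the inverse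
      -- is `-T` itself.
      by_cases hz1 : 1 + z = 0
      · refine ⟨-T, fun u => ?_, fun f => ?_⟩
        · have h1 := hval u
          have h2 : z = -1 := by linear_combination hz1
          conv_rhs => rw [h1]
          rw [h2, neg_apply, ← map_neg]
          congr 1
          module
        · have h2 : z = -1 := by linear_combination hz1
          obtain ⟨h, h'⟩ := hdom (-T f) (T f - f) (by rw [← map_neg]; congr 1; rw [map_neg]; abel)
          refine ⟨h, ?_⟩
          have h3 : L ⟨(-T) f, h⟩ = T f - f := h'
          rw [h3, h2]
          simp
      · have hμ0 : (1 + z)⁻¹ ≠ 0 := inv_ne_zero hz1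
        -- Fredholm alternative for the compact operator `T` at a nonzero point.
        rcases hc.hasEigenvalue_or_mem_resolventSet hμ0 with h | h
        · exfalso
          apply hz'
          obtain ⟨r, hr0, hr1, hr⟩ := exists_real_of_hasEigenvalue hs hinj hpos hcontr h
          have e : z = ((r⁻¹ - 1 : ℝ) : ℂ) := by
            push_cast
            rw [← hr]
            simp
          have hSr : (r⁻¹ - 1) ∈ S := by
            refine ⟨sub_nonneg.2 ((one_le_inv₀ hr0).2 hr1), ?_⟩
            rw [hr] at h
            simpa using h
          rw [← hrange] at hSr
          obtain ⟨m, hm⟩ := hSr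
          exact ⟨m, by rw [e]; simp only [hm]⟩
        · rw [spectrum.mem_resolventSet_iff] at h
          obtain ⟨U, hU⟩ := h
          set μ := (1 + z)⁻¹
          have hμz : μ * (1 + z) = 1 := inv_mul_cancel₀ hz1
          set A : E →L[ℂ] E := ((U⁻¹ : (E →L[ℂ] E)ˣ) : E →L[ℂ] E)
          have hUx : ∀ x, (U : E →L[ℂ] E) x = μ • x - T x := by
            intro x
            rw [hU]
            simp [Algebra.algebraMap_eq_smul_one]
          have hAU : ∀ x, A (μ • x - T x) = x := by
            intro x
            rw [← hUx]
            exact congrArg (fun B : E →L[ℂ] E => B x) U.inv_mul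
          have hUA : ∀ x, μ • A x - T (A x) = x := by
            intro x
            rw [← hUx]
            exact congrArg (fun B : E →L[ℂ] E => B x) U.mul_inv
          -- From `z - L = (1 + z) - T⁻¹` and `μ = (1 + z)⁻¹`, the inverse is `-μ (μ - T)⁻¹ T`.
          refine ⟨-(μ • (A ∘L T)), fun u => ?_, fun f => ?_⟩
          · have h1 := hval u
            have h2 : T (z • (u : E) - L u) = (1 + z) • T u - u := by
              have : z • (u : E) - L u = (1 + z) • (u : E) - (u + L u) := by module
              rw [this, map_sub, ← h1, map_smul]
            have h3 : -(μ • ((1 + z) • T u - (u : E))) = μ • (u : E) - T u := by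
              rw [smul_sub, smul_smul, hμz]
              module
            change -(μ • A (T (z • (u : E) - L u))) = u
            rw [h2, ← map_smul, ← map_neg, h3, hAU]
          · set u : E := (-(μ • (A ∘L T))) f with hu
            have hu1 : μ • u - T u = -(μ • T f) := by
              have : u = A (-(μ • T f)) := by
                rw [hu, map_neg, map_smul]
                rfl
              rw [this, hUA]
            obtain ⟨h, h'⟩ := hdom u (z • u - f) (by
              have e1 : u + (z • u - f) = (1 + z) • u - f := by module
              have e2 : (1 + z) • (μ • u - T u) = (1 + z) • -(μ • T f) := by rw [hu1]
              have e3 : u - (1 + z) • T u = - T f := by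
                rw [smul_sub, smul_neg, smul_smul, smul_smul, mul_comm, hμz, one_smul,
                  one_smul] at e2
                exact e2
              rw [e1, map_sub, map_smul]
              linear_combination (norm := module) e3)
            refine ⟨h, ?_⟩
            rw [h']
            abel
    · rintro ⟨m, rfl⟩ ⟨R, hR, -⟩
      obtain ⟨v, hv, hv0⟩ := (hmem m).2.exists_hasEigenvector
      obtain ⟨h, h'⟩ := (heigvec (eig m) (hmem m).1 v).1 (mem_eigenspace_iff.1 hv)
      have h1 := hR ⟨v, h⟩
      rw [h'] at h1
      simp only [sub_self, map_zero] at h1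
      exact hv0 h1.symm
  · have hmemE : ∀ u : L.domain, u ∈ unboundedEigenspace L (eig m : ℂ) ↔
        L u = (eig m : ℂ) • (u : E) := by
      intro u
      rw [unboundedEigenspace, LinearMap.mem_ker]
      exact sub_eq_zero
    constructor
    · obtain ⟨v, hv, hv0⟩ := (hmem m).2.exists_hasEigenvector
      obtain ⟨h, h'⟩ := (heigvec (eig m) (hmem m).1 v).1 (mem_eigenspace_iff.1 hv)
      intro hbot
      have h1 := (hmemE ⟨v, h⟩).2 h'
      rw [hbot, Submodule.mem_bot] at h1
      exact hv0 (congrArg Subtype.val h1)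
    · have hpos' : 0 < 1 + eig m := by linarith [(hmem m).1]
      have hfd : FiniteDimensional ℂ
          (eigenspace (T : Module.End ℂ E) ((1 + eig m : ℝ) : ℂ)⁻¹) :=
        T.finite_dimensional_eigenspace hc _
          (inv_ne_zero (Complex.ofReal_ne_zero.2 hpos'.ne'))
      let ι : unboundedEigenspace L (eig m : ℂ) →ₗ[ℂ]
          eigenspace (T : Module.End ℂ E) ((1 + eig m : ℝ) : ℂ)⁻¹ :=
        LinearMap.codRestrict _ (L.domain.subtype ∘ₗ Submodule.subtype _) fun u =>
          mem_eigenspace_iff.2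
            ((heigvec (eig m) (hmem m).1 _).2 ⟨u.1.2, (hmemE u.1).1 u.2⟩)
      refine FiniteDimensional.of_injective ι fun u v huv => ?_
      exact Subtype.ext (Subtype.ext (by have h := congrArg Subtype.val huv; exact h))

end CompactResolvent

/-! ### The resolvent of a closed form as `J J†` -/

section FormResolvent

variable {V H : Type*} [NormedAddCommGroup V] [InnerProductSpace ℂ V]
  [NormedAddCommGroup H] [InnerProductSpace ℂ H] [CompleteSpace H] (J : V →L[ℂ] H)

/-- After embedding by `ι`, `J` is an operator-norm limit of compact operators. The larger space `X`
lets the approximations leave the image of `H`; compactness returns to `H` because an isometry from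
a complete space is a closed embedding. -/
theorem isCompactOperator_of_approx {X : Type*} [NormedAddCommGroup X] [NormedSpace ℂ X]
    [CompleteSpace X] (ι : H →ₗᵢ[ℂ] X) {F : ℕ → X →L[ℂ] X}
    (hF : ∀ k, IsCompactOperator (F k)) {C : ℝ} (hC : 0 ≤ C)
    (hbound : ∀ k p, ‖ι (J p) - F k (ι (J p))‖ ≤ C * (1 / ((k : ℝ) + 1)) * ‖p‖) :
    IsCompactOperator J := by
  set A : V →L[ℂ] X := ι.toContinuousLinearMap ∘L J
  have hA : IsCompactOperator A := by
    refine isCompactOperator_of_tendsto (l := atTop) (F := fun k => F k ∘L A) ?_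
      (Eventually.of_forall fun k => (hF k).comp_clm A)
    rw [tendsto_iff_norm_sub_tendsto_zero]
    refine squeeze_zero (fun _ => norm_nonneg _) (fun k => ?_)
      (by simpa using (tendsto_one_div_add_atTop_nhds_zero_nat (𝕜 := ℝ)).const_mul C)
    refine ContinuousLinearMap.opNorm_le_bound _ (by positivity) fun p => ?_
    rw [← norm_neg]
    have h := hbound k p
    simpa [A] using h
  obtain ⟨S, hS, hS'⟩ := hA
  exact ⟨ι ⁻¹' S, ι.isometry.isClosedEmbedding.isCompact_preimage hS, hS'⟩

variable [CompleteSpace V]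

/-- The operator `J J†`.  If `V` is the domain of a closed form on `H`, with the form norm, and `J`
is the inclusion, then this is the resolvent of the operator of the form. -/
def formResolvent : H →L[ℂ] H := J ∘L ContinuousLinearMap.adjoint J

theorem inner_formResolvent (f g : H) :
    inner ℂ f (formResolvent J g) =
      inner ℂ (ContinuousLinearMap.adjoint J f) (ContinuousLinearMap.adjoint J g) := by
  rw [ContinuousLinearMap.adjoint_inner_left]
  rfl

theorem isSymmetric_formResolvent : (formResolvent J).IsSymmetric := by
  intro f g
  change inner ℂ (formResolvent J f) g = inner ℂ f (formResolvent J g)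
  rw [← inner_conj_symm, inner_formResolvent, inner_formResolvent, inner_conj_symm]

theorem norm_formResolvent_apply_le (hJ : ‖J‖ ≤ 1) (f : H) : ‖formResolvent J f‖ ≤ ‖f‖ := by
  have h' : ‖ContinuousLinearMap.adjoint J‖ ≤ 1 := by
    rwa [LinearIsometryEquiv.norm_map]
  have h1 := ContinuousLinearMap.le_of_opNorm_le _ hJ (ContinuousLinearMap.adjoint J f)
  have h2 := ContinuousLinearMap.le_of_opNorm_le _ h' f
  rw [one_mul] at h1 h2
  exact h1.trans h2

/-- `J† h` is the Riesz representative of `q ↦ ⟨J q, h⟩` up to conjugation, so the resolvent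
equation is a variational problem, with no operator inverse in it. -/
theorem eq_formResolvent_iff (u h : H) :
    u = formResolvent J h ↔ ∃ p, J p = u ∧ ∀ q, inner ℂ q p = inner ℂ (J q) h := by
  constructor
  · rintro rfl
    exact ⟨_, rfl, fun q => ContinuousLinearMap.adjoint_inner_right J q h⟩
  · rintro ⟨p, rfl, hq⟩
    have : ContinuousLinearMap.adjoint J h = p := by
      refine ext_inner_left ℂ fun q => ?_
      rw [ContinuousLinearMap.adjoint_inner_right, hq]
    rw [formResolvent, ContinuousLinearMap.comp_apply, this]

/-- `⟨x, J J† x⟩ = ‖J† x‖²`, so a vector in the kernel is orthogonal to the range of `J`, which is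
dense. -/
theorem injective_formResolvent (hJ : ∀ x, (∀ p, inner ℂ (J p) x = 0) → x = 0) :
    Function.Injective (formResolvent J) := by
  rw [injective_iff_map_eq_zero]
  intro x hx
  have h0 : ContinuousLinearMap.adjoint J x = 0 := by
    rw [← inner_self_eq_zero (𝕜 := ℂ), ← inner_formResolvent, hx, inner_zero_right]
  refine hJ x fun p => ?_
  rw [← ContinuousLinearMap.adjoint_inner_right, h0, inner_zero_right]

/-- Discreteness of the spectrum of the operator of a closed form with compactly embedded domain. -/
theorem exists_eigenvalues_of_form (hH : ¬ FiniteDimensional ℂ H) (hJ : ‖J‖ ≤ 1)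
    (hc : IsCompactOperator J) (hdense : ∀ x, (∀ p, inner ℂ (J p) x = 0) → x = 0)
    (L : H →ₗ.[ℂ] H)
    (hL : ∀ u f, (u, f) ∈ L.graph ↔
      ∃ p, J p = u ∧ ∀ q, inner ℂ q p = inner ℂ (J q) (u + f)) :
    ∃ eig : ℕ → ℝ, StrictMono eig ∧ (∀ m, 0 ≤ eig m) ∧ Tendsto eig atTop atTop ∧
      unboundedSpectrum L = Set.range (fun m => (eig m : ℂ)) ∧
      ∀ m, unboundedEigenspace L (eig m : ℂ) ≠ ⊥ ∧
        FiniteDimensional ℂ (unboundedEigenspace L (eig m : ℂ)) := by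
  refine exists_eigenvalues_of_compact_resolvent (T := formResolvent J) hH (hc.comp_clm _)
    (isSymmetric_formResolvent J) (injective_formResolvent J hdense) (fun x => ?_)
    (norm_formResolvent_apply_le J hJ) L fun u f => ?_
  · rw [inner_formResolvent]
    exact inner_self_nonneg
  · rw [hL, eq_formResolvent_iff]

end FormResolvent

/-! ### The operator `A†A` in terms of the graph of `A` -/

section GraphResolvent

variable {H K : Type*} [NormedAddCommGroup H] [InnerProductSpace ℂ H]
  [NormedAddCommGroup K] [InnerProductSpace ℂ K]

/-- A subspace of `H × K` with its Hilbert norm. -/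
def graphSpace (R : Submodule ℂ (H × K)) : Submodule ℂ (WithLp 2 (H × K)) :=
  R.comap (WithLp.linearEquiv 2 ℂ (H × K)).toLinearMap

/-- The projection to the first factor. -/
def graphProj (R : Submodule ℂ (H × K)) : graphSpace R →L[ℂ] H :=
  WithLp.fstL 2 ℂ H K ∘L (graphSpace R).subtypeL

theorem inner_graphSpace {R : Submodule ℂ (H × K)} (p q : graphSpace R) :
    inner ℂ p q = inner ℂ p.1.fst q.1.fst + inner ℂ p.1.snd q.1.snd := rfl

theorem norm_graphSpace_sq {R : Submodule ℂ (H × K)} (p : graphSpace R) :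
    ‖p‖ ^ 2 = ‖p.1.fst‖ ^ 2 + ‖p.1.snd‖ ^ 2 :=
  WithLp.prod_norm_sq_eq_of_L2 p.1

theorem norm_graphProj_le (R : Submodule ℂ (H × K)) : ‖graphProj R‖ ≤ 1 := by
  refine ContinuousLinearMap.opNorm_le_bound _ zero_le_one fun p => ?_
  rw [one_mul]
  refine le_of_sq_le_sq ?_ (norm_nonneg p)
  rw [norm_graphSpace_sq]
  exact le_add_of_nonneg_right (sq_nonneg _)

/-- Discreteness of the spectrum of `A†A`, where `R` is the graph of `A`. -/
theorem exists_eigenvalues_of_graph [CompleteSpace H] [CompleteSpace K]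
    {R : Submodule ℂ (H × K)} (hR : IsClosed (R : Set (H × K))) (hH : ¬ FiniteDimensional ℂ H)
    {X : Type*} [NormedAddCommGroup X] [NormedSpace ℂ X] [CompleteSpace X] (ι : H →ₗᵢ[ℂ] X)
    {F : ℕ → X →L[ℂ] X} (hF : ∀ k, IsCompactOperator (F k)) {C : ℝ} (hC : 0 ≤ C)
    (hbound : ∀ (k : ℕ), ∀ p ∈ R, ((k : ℝ) + 1) ^ 2 * ‖ι p.1 - F k (ι p.1)‖ ^ 2 ≤
      C * (‖p.1‖ ^ 2 + ‖p.2‖ ^ 2))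
    (hdense : ∀ x, (∀ p ∈ R, inner ℂ p.1 x = 0) → x = 0) (L : H →ₗ.[ℂ] H)
    (hL : ∀ u f, (u, f) ∈ L.graph ↔
      ∃ y, (u, y) ∈ R ∧ ∀ q ∈ R, inner ℂ q.2 y = inner ℂ q.1 f) :
    ∃ eig : ℕ → ℝ, StrictMono eig ∧ (∀ m, 0 ≤ eig m) ∧ Tendsto eig atTop atTop ∧
      unboundedSpectrum L = Set.range (fun m => (eig m : ℂ)) ∧
      ∀ m, unboundedEigenspace L (eig m : ℂ) ≠ ⊥ ∧
        FiniteDimensional ℂ (unboundedEigenspace L (eig m : ℂ)) := by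
  have hclosed : IsClosed (graphSpace R : Set (WithLp 2 (H × K))) :=
    hR.preimage (WithLp.prod_continuous_ofLp 2 H K)
  have : CompleteSpace (graphSpace R) := hclosed.completeSpace_coe
  refine exists_eigenvalues_of_form (graphProj R) hH (norm_graphProj_le R) ?_ (fun x hx => ?_) L
    fun u f => ?_
  · refine isCompactOperator_of_approx _ ι hF (Real.sqrt_nonneg C) fun k p => ?_
    have hk : (0 : ℝ) < (k : ℝ) + 1 := by positivity
    have h1 : _ ≤ C * (‖p.1.fst‖ ^ 2 + ‖p.1.snd‖ ^ 2) := hbound k _ p.2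
    rw [mul_one_div, div_mul_eq_mul_div, le_div_iff₀ hk]
    -- The squared hypothesis with constant `C` becomes a bound by `√C / (k + 1)`.
    refine le_of_sq_le_sq ?_ (by positivity)
    rw [mul_pow, mul_pow, Real.sq_sqrt hC, norm_graphSpace_sq, mul_comm]
    exact h1
  · exact hdense x fun p hp => hx ⟨WithLp.toLp 2 p, hp⟩
  -- The graph inner product contributes `⟨q.1, u⟩` on the left, which cancels the `u` in `u + f` on
  -- the right.
  · rw [hL]
    constructor
    · rintro ⟨y, hy, h⟩
      refine ⟨⟨WithLp.toLp 2 (u, y), hy⟩, rfl, fun q => ?_⟩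
      have h1 : inner ℂ q.1.snd y = inner ℂ q.1.fst f := h _ q.2
      rw [inner_graphSpace, inner_add_right]
      exact congrArg _ h1
    · rintro ⟨p, rfl, h⟩
      refine ⟨p.1.snd, p.2, fun q hq => ?_⟩
      have h1 := h ⟨WithLp.toLp 2 q, hq⟩
      rw [inner_graphSpace, inner_add_right] at h1
      exact add_left_cancel h1

end GraphResolvent

/-! ### Fourier series on the torus -/

section Fourier

variable (b : Module.Basis (Fin 2) ℝ Plane)

/-- The element of the reciprocal lattice with coordinates `2πm` in the dual basis of `b`. -/
def frequency (m : Fin 2 → ℤ) : Plane :=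
  (InnerProductSpace.toDual ℝ Plane).symm
    (LinearMap.toContinuousLinearMap (∑ i, (2 * Real.pi * (m i : ℝ)) • b.coord i))

theorem inner_frequency (m : Fin 2 → ℤ) (x : Plane) :
    inner ℝ (frequency b m) x = ∑ i, 2 * Real.pi * (m i : ℝ) * b.repr x i := by
  rw [frequency, InnerProductSpace.toDual_symm_apply]
  simp

theorem inner_frequency_basis (m : Fin 2 → ℤ) (j : Fin 2) :
    inner ℝ (frequency b m) (b j) = 2 * Real.pi * (m j : ℝ) := by
  rw [inner_frequency, Finset.sum_eq_single j]
  · simp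
  · intro i _ hij
    simp [Finsupp.single_eq_of_ne hij]
  · simp

theorem frequency_neg (m : Fin 2 → ℤ) : frequency b (-m) = -frequency b m := by
  refine ext_inner_right ℝ fun x => ?_
  rw [inner_neg_left, inner_frequency, inner_frequency]
  simp [Finset.sum_neg_distrib]

theorem frequency_sub (m l : Fin 2 → ℤ) :
    frequency b (m - l) = frequency b m - frequency b l := by
  refine ext_inner_right ℝ fun x => ?_
  rw [inner_sub_left, inner_frequency, inner_frequency, inner_frequency, ← Finset.sum_sub_distrib]
  refine Finset.sum_congr rfl fun i _ => ?_
  rw [Pi.sub_apply]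
  push_cast
  ring

/-- The frequency has inner product `2π m j` with `b j`, so Cauchy–Schwarz bounds each integer `m
j`. -/
theorem finite_setOf_norm_frequency_le (R : ℝ) :
    {m : Fin 2 → ℤ | ‖frequency b m‖ ≤ R}.Finite := by
  refine (Set.Finite.pi' (fun j : Fin 2 =>
    Set.finite_Icc (-⌈R * ‖b j‖⌉) ⌈R * ‖b j‖⌉)).subset fun m hm j => ?_
  have h1 : |2 * Real.pi * (m j : ℝ)| ≤ R * ‖b j‖ := by
    rw [← inner_frequency_basis]
    exact (abs_real_inner_le_norm _ _).trans
      (mul_le_mul_of_nonneg_right hm (norm_nonneg _))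
  have h2 : |(m j : ℝ)| ≤ R * ‖b j‖ := by
    refine le_trans ?_ h1
    rw [abs_mul, abs_of_pos Real.two_pi_pos]
    exact le_mul_of_one_le_left (abs_nonneg _) (by linarith [Real.pi_gt_three])
  have h3 := abs_le.1 (h2.trans (Int.le_ceil _))
  refine Set.mem_Icc.2 ⟨?_, ?_⟩
  · exact_mod_cast h3.1
  · exact_mod_cast h3.2

/-- The plane wave `x ↦ exp(i g · x)` of frequency `g = frequency b m`. -/
def mode (m : Fin 2 → ℤ) (x : Plane) : ℂ :=
  Complex.exp ((inner ℝ (frequency b m) x : ℝ) * Complex.I)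

theorem mode_add (m : Fin 2 → ℤ) (x y : Plane) :
    mode b m (x + y) = mode b m x * mode b m y := by
  rw [mode, mode, mode, inner_add_right, ← Complex.exp_add, Complex.ofReal_add, add_mul]

theorem conj_mode_mul_mode (m l : Fin 2 → ℤ) (x : Plane) :
    starRingEnd ℂ (mode b m x) * mode b l x = mode b (l - m) x := by
  rw [mode, mode, mode, ← Complex.exp_conj, ← Complex.exp_add, frequency_sub, inner_sub_left]
  congr 1
  simp
  ring

theorem mode_neg (m : Fin 2 → ℤ) (x : Plane) : mode b (-m) x = starRingEnd ℂ (mode b m x) := by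
  rw [mode, mode, ← Complex.exp_conj, frequency_neg, inner_neg_left]
  simp

theorem mode_zero (x : Plane) : mode b 0 x = 1 := by
  rw [mode, inner_frequency]
  simp

theorem mode_lattice (m : Fin 2 → ℤ) {k : Plane} (hk : k ∈ lattice b) : mode b m k = 1 := by
  rw [mode, Complex.exp_eq_one_iff, inner_frequency]
  rw [Module.Basis.mem_span_iff_repr_mem] at hk
  choose c hc using hk
  refine ⟨∑ i, m i * c i, ?_⟩
  simp only [← hc]
  push_cast
  rw [Finset.sum_mul, Finset.sum_mul]
  refine Finset.sum_congr rfl fun i _ => ?_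
  simp
  ring

theorem contDiff_mode (m : Fin 2 → ℤ) : ContDiff ℝ ∞ (mode b m) := by
  unfold mode
  refine Complex.contDiff_exp.comp (ContDiff.mul ?_ contDiff_const)
  exact Complex.ofRealCLM.contDiff.comp (contDiff_const.inner ℝ contDiff_id)

theorem isTest_mode (m : Fin 2 → ℤ) : IsTest b (mode b m) :=
  ⟨contDiff_mode b m, fun k hk x => by rw [mode_add, mode_lattice b m hk, mul_one]⟩

theorem hasFDerivAt_mode (m : Fin 2 → ℤ) (x : Plane) :
    HasFDerivAt (mode b m) ((mode b m x * Complex.I) •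
      (Complex.ofRealCLM ∘L innerSL ℝ (frequency b m))) x := by
  have h1 : HasFDerivAt (fun y : Plane => (inner ℝ (frequency b m) y : ℂ))
      (Complex.ofRealCLM ∘L innerSL ℝ (frequency b m)) x :=
    (Complex.ofRealCLM ∘L innerSL ℝ (frequency b m)).hasFDerivAt
  have h2 := (h1.mul_const Complex.I).cexp
  convert! h2 using 1
  rw [mode, smul_smul]

theorem partialDeriv_mode (m : Fin 2 → ℤ) (j : Fin 2) (x : Plane) :
    partialDeriv j (mode b m) x = Complex.I * (frequency b m j : ℂ) * mode b m x := by
  rw [partialDeriv, (hasFDerivAt_mode b m x).fderiv]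
  simp [EuclideanSpace.inner_single_right]
  ring

instance isFiniteMeasure_cellMeasure : IsFiniteMeasure (cellMeasure b) := ⟨by
  rw [Measure.restrict_apply_univ]
  exact (ZSpan.fundamentalDomain_isBounded b).measure_lt_top⟩

open scoped Pointwise in
/-- Integrals of periodic functions over the cell are invariant under translations. -/
theorem setIntegral_cell_add {f : Plane → ℂ} (hf : ∀ k ∈ lattice b, ∀ x, f (x + k) = f x)
    (a : Plane) : ∫ x in cell b, f (x + a) = ∫ x in cell b, f x := by
  have : Countable (lattice b).toAddSubgroup := inferInstanceAs (Countable (lattice b))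
  -- The cell and its translate are both fundamental domains of the lattice, so a periodic function
  -- has the same integral over each.
  have h1 : IsAddFundamentalDomain (lattice b).toAddSubgroup (cell b) (volume : Measure Plane) :=
    ZSpan.isAddFundamentalDomain' b volume
  have h2 : IsAddFundamentalDomain (lattice b).toAddSubgroup (a +ᵥ cell b) (volume : Measure Plane) :=
    h1.vadd_of_comm a
  rw [h1.setIntegral_eq h2 (f := f) (fun k x => by
    rw [AddSubgroup.vadd_def, vadd_eq_add, add_comm, hf k k.2])]
  have h3 := (measurePreserving_add_right (volume : Measure Plane) a).setIntegral_image_emb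
    (measurableEmbedding_addRight a) f (cell b)
  rw [← h3]
  have h4 : a +ᵥ cell b = (fun x => x + a) '' cell b := Set.image_congr fun x _ => add_comm a x
  rw [h4]

theorem setIntegral_mode (m : Fin 2 → ℤ) (hm : m ≠ 0) : ∫ x in cell b, mode b m x = 0 := by
  obtain ⟨j, hj⟩ := Function.ne_iff.1 hm
  have hj' : (m j : ℝ) ≠ 0 := by exact_mod_cast hj
  -- Translation by `a` advances the phase by exactly `π`, so the integral equals its own negative.
  set a : Plane := (2 * (m j : ℝ))⁻¹ • b j
  have ha : mode b m a = -1 := by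
    rw [mode, inner_smul_right, inner_frequency_basis, ← Complex.exp_pi_mul_I]
    congr 2
    field_simp
  have h := setIntegral_cell_add b (isTest_mode b m).2 a
  simp only [mode_add, ha, mul_neg, mul_one, integral_neg] at h
  exact self_eq_neg.1 h.symm

/-- The area of the cell. -/
def area : ℝ := volume.real (cell b)

theorem area_pos : 0 < area b :=
  ENNReal.toReal_pos (ZSpan.measure_fundamentalDomain_ne_zero b)
    (ZSpan.fundamentalDomain_isBounded b).measure_lt_top.ne

theorem memLp_of_continuous {f : Plane → ℂ} (hf : Continuous f) : MemLp f 2 (cellMeasure b) := by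
  obtain ⟨C, hC⟩ := (ZSpan.fundamentalDomain_isBounded
    b).isCompact_closure.exists_bound_of_continuousOn hf.continuousOn
  refine MemLp.of_bound hf.aestronglyMeasurable C ?_
  refine (ae_restrict_iff' (ZSpan.fundamentalDomain_measurableSet b)).2 (Eventually.of_forall ?_)
  exact fun x hx => hC x (subset_closure hx)

/-- The class in `L²(Q')` of a continuous function. -/
def toL2 (f : Plane → ℂ) (hf : Continuous f) : L2 b := (memLp_of_continuous b hf).toLp f

theorem coeFn_toL2 {f : Plane → ℂ} (hf : Continuous f) : toL2 b f hf =ᵐ[cellMeasure b] f :=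
  MemLp.coeFn_toLp _

theorem pairing_toL2 {f : Plane → ℂ} (hf : Continuous f) (ψ : Plane → ℂ) :
    pairing b (toL2 b f hf) ψ = ∫ x in cell b, f x * ψ x := by
  refine integral_congr_ae ?_
  filter_upwards [coeFn_toL2 b hf] with x hx
  rw [hx]

theorem inner_toL2 {f : Plane → ℂ} (hf : Continuous f) (u : L2 b) :
    inner ℂ (toL2 b f hf) u = pairing b u fun x => starRingEnd ℂ (f x) := by
  rw [L2.inner_def]
  refine integral_congr_ae ?_
  filter_upwards [coeFn_toL2 b hf] with x hx
  rw [hx]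
  simp

/-- The normalized plane wave. -/
def modeL2 (m : Fin 2 → ℤ) : L2 b :=
  (((Real.sqrt (area b))⁻¹ : ℝ) : ℂ) • toL2 b (mode b m) (isTest_mode b m).continuous

theorem orthonormal_modeL2 : Orthonormal ℂ (modeL2 b) := by
  have ha := area_pos b
  rw [orthonormal_iff_ite]
  intro m l
  have hc : inner ℂ (toL2 b (mode b m) (isTest_mode b m).continuous)
      (toL2 b (mode b l) (isTest_mode b l).continuous) = ∫ x in cell b, mode b (l - m) x := by
    rw [inner_toL2, pairing_toL2]
    simp only [← conj_mode_mul_mode, mul_comm]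
  rw [modeL2, modeL2, inner_smul_left, inner_smul_right, hc]
  split_ifs with h
  · subst h
    simp only [sub_self, mode_zero, Complex.conj_ofReal]
    rw [setIntegral_const, ← area]
    norm_cast
    rw [Complex.real_smul, mul_one]
    norm_cast
    rw [← mul_assoc, ← mul_inv, Real.mul_self_sqrt ha.le, inv_mul_cancel₀ ha.ne']
  · rw [setIntegral_mode b _ (sub_ne_zero.2 (Ne.symm h))]
    simp

/-- The projection of the plane onto the standard torus, in the coordinates of `b`. -/
def torusMap (x : Plane) : UnitAddTorus (Fin 2) := fun i => (b.repr x i : UnitAddCircle)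

theorem isOpenQuotientMap_torusMap : IsOpenQuotientMap (torusMap b) := by
  have h1 : IsOpenQuotientMap (Pi.map fun (_ : Fin 2) (t : ℝ) => (t : UnitAddCircle)) :=
    IsOpenQuotientMap.piMap fun _ => QuotientAddGroup.isOpenQuotientMap_mk
  exact h1.comp b.equivFunL.toHomeomorph.isOpenQuotientMap

theorem sub_mem_lattice_of_torusMap_eq {x y : Plane} (h : torusMap b x = torusMap b y) :
    x - y ∈ lattice b := by
  rw [Module.Basis.mem_span_iff_repr_mem]
  intro i
  have h1 : ((b.repr x i : ℝ) : UnitAddCircle) = (b.repr y i : ℝ) := congrFun h i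
  rw [← sub_eq_zero, ← AddCircle.coe_sub, AddCircle.coe_eq_zero_iff] at h1
  obtain ⟨n, hn⟩ := h1
  exact ⟨n, by simpa using hn⟩

theorem mFourier_torusMap (m : Fin 2 → ℤ) (x : Plane) :
    UnitAddTorus.mFourier m (torusMap b x) = mode b m x := by
  rw [mode, inner_frequency, Complex.ofReal_sum, Finset.sum_mul, Complex.exp_sum,
    UnitAddTorus.mFourier, ContinuousMap.coe_mk]
  refine Finset.prod_congr rfl fun i _ => ?_
  change fourier (m i) ((b.repr x i : ℝ) : UnitAddCircle) = _
  rw [fourier_coe_apply]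
  congr 1
  push_cast
  ring

/-- The functional `F ↦ ∫ u F` on continuous functions on the torus. -/
def torusPairing (u : L2 b) : C(UnitAddTorus (Fin 2), ℂ) →L[ℂ] ℂ :=
  LinearMap.mkContinuous
    { toFun := fun F => pairing b u (fun x => F (torusMap b x))
      map_add' := fun F G => by
        have hc := (isOpenQuotientMap_torusMap b).continuous
        unfold pairing
        have h := integral_add (integrable_pairing b u (F.continuous.comp hc))
          (integrable_pairing b u (G.continuous.comp hc))
        simp only [Function.comp_apply] at h
        rw [← h]
        simp only [ContinuousMap.add_apply, mul_add]
      map_smul' := fun c F => by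
        unfold pairing
        rw [RingHom.id_apply, smul_eq_mul, ← integral_const_mul]
        simp only [ContinuousMap.smul_apply, smul_eq_mul, mul_left_comm] }
    (∫ x in cell b, ‖u x‖) fun F => by
      have hu : Integrable u (cellMeasure b) := (Lp.memLp u).integrable (by norm_num)
      rw [← integral_mul_const]
      refine norm_integral_le_of_norm_le (hu.norm.mul_const _) (Eventually.of_forall fun x => ?_)
      rw [norm_mul]
      exact mul_le_mul_of_nonneg_left (F.norm_coe_le_norm _) (norm_nonneg _)

/-- Trigonometric polynomials are uniformly dense in the continuous functions on the torus, and
pairing with `u` is continuous for the uniform norm. Combined with `eq_zero_of_pairing`, this gives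
completeness of the plane waves. -/
theorem pairing_eq_zero_of_forall_mode {u : L2 b} (h : ∀ m, pairing b u (mode b m) = 0)
    {φ : Plane → ℂ} (hφ : IsTest b φ) : pairing b u φ = 0 := by
  have h0 : torusPairing b u = 0 := by
    have h1 : (⊤ : Submodule ℂ C(UnitAddTorus (Fin 2), ℂ)) ≤
        LinearMap.ker (torusPairing b u : C(UnitAddTorus (Fin 2), ℂ) →ₗ[ℂ] ℂ) := by
      rw [← UnitAddTorus.span_mFourier_closure_eq_top]
      refine Submodule.topologicalClosure_minimal _ (Submodule.span_le.2 ?_)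
        (torusPairing b u).isClosed_ker
      rintro _ ⟨m, rfl⟩
      change pairing b u (fun x => UnitAddTorus.mFourier m (torusMap b x)) = 0
      simp only [mFourier_torusMap]
      exact h m
    ext F
    exact h1 (Submodule.mem_top (x := F))
  -- A periodic function is constant on the fibres of the quotient map `torusMap`, so it descends to
  -- the torus.
  obtain ⟨F, hF⟩ : ∃ F : C(UnitAddTorus (Fin 2), ℂ), ∀ x, F (torusMap b x) = φ x := by
    let p : C(Plane, UnitAddTorus (Fin 2)) :=
      ⟨torusMap b, (isOpenQuotientMap_torusMap b).continuous⟩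
    have hp : IsQuotientMap p := (isOpenQuotientMap_torusMap b).isQuotientMap
    have hf : Function.FactorsThrough (⟨φ, hφ.continuous⟩ : C(Plane, ℂ)) p := fun x y hxy => by
      have := hφ.2 _ (sub_mem_lattice_of_torusMap_eq b hxy) y
      rw [add_sub_cancel] at this
      exact this
    exact ⟨hp.lift _ hf, fun x => ContinuousMap.congr_fun (hp.lift_comp _ hf) x⟩
  have h2 : torusPairing b u F = 0 := by rw [h0]; rfl
  rw [← h2]
  change _ = pairing b u (fun x => F (torusMap b x))
  simp only [hF]

/-- The pairing is bilinear, without conjugation; this is why the coefficient of index `m` is read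
off by testing with the mode `-m`. -/
theorem pairing_mode_neg (u : L2 b) (m : Fin 2 → ℤ) :
    pairing b u (mode b (-m)) = (Real.sqrt (area b) : ℂ) * inner ℂ (modeL2 b m) u := by
  have ha : Real.sqrt (area b) ≠ 0 := (Real.sqrt_pos.2 (area_pos b)).ne'
  rw [modeL2, inner_smul_left, inner_toL2, Complex.conj_ofReal, ← mul_assoc,
    ← Complex.ofReal_mul, mul_inv_cancel₀ ha, Complex.ofReal_one, one_mul]
  congr 1
  ext x
  exact mode_neg b m x

/-- The Fourier basis of `L²(Q')`. -/
def fourierHilbertBasis : HilbertBasis (Fin 2 → ℤ) ℂ (L2 b) :=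
  HilbertBasis.mkOfOrthogonalEqBot (orthonormal_modeL2 b) (by
    rw [Submodule.eq_bot_iff]
    intro u hu
    refine eq_zero_of_pairing b fun φ hφ => pairing_eq_zero_of_forall_mode b (fun m => ?_) hφ
    have h1 := pairing_mode_neg b u (-m)
    rw [neg_neg] at h1
    rw [h1, (Submodule.mem_orthogonal _ _).1 hu _ (Submodule.subset_span ⟨-m, rfl⟩), mul_zero])

theorem fourierHilbertBasis_apply (m : Fin 2 → ℤ) : fourierHilbertBasis b m = modeL2 b m :=
  congrFun (HilbertBasis.coe_mkOfOrthogonalEqBot _ _) m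

end Fourier

/-! ### Weak differential operators as Fourier multipliers -/

section Coefficients

variable (b : Module.Basis (Fin 2) ℝ Plane)

/-- The Fourier coefficient of index `m`. -/
def coeff (m : Fin 2 → ℤ) : L2 b →L[ℂ] ℂ := innerSL ℂ (modeL2 b m)

theorem coeff_apply (m : Fin 2 → ℤ) (u : L2 b) : coeff b m u = inner ℂ (modeL2 b m) u := rfl

variable {b}

theorem coeff_eq_repr (m : Fin 2 → ℤ) (u : L2 b) :
    coeff b m u = (fourierHilbertBasis b).repr u m := by
  rw [HilbertBasis.repr_apply_apply, fourierHilbertBasis_apply, coeff_apply]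

theorem ext_coeff {u v : L2 b} (h : ∀ m, coeff b m u = coeff b m v) : u = v := by
  refine (fourierHilbertBasis b).repr.injective (lp.ext (funext fun m => ?_))
  rw [← coeff_eq_repr, ← coeff_eq_repr, h]

theorem exists_coeff_eq {c : (Fin 2 → ℤ) → ℂ} (hc : Summable fun m => ‖c m‖ ^ 2) :
    ∃ u : L2 b, ∀ m, coeff b m u = c m := by
  have h : Memℓp c 2 := memℓp_gen (by simpa using hc)
  refine ⟨(fourierHilbertBasis b).repr.symm ⟨c, h⟩, fun m => ?_⟩
  rw [coeff_eq_repr, LinearIsometryEquiv.apply_symm_apply]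

theorem hasSum_inner_coeff (u v : L2 b) :
    HasSum (fun m => starRingEnd ℂ (coeff b m u) * coeff b m v) (inner ℂ u v) := by
  have h := (fourierHilbertBasis b).hasSum_inner_mul_inner u v
  simp only [fourierHilbertBasis_apply] at h
  simpa only [coeff_apply, inner_conj_symm] using h

theorem hasSum_norm_coeff_sq (u : L2 b) :
    HasSum (fun m => ‖coeff b m u‖ ^ 2) (‖u‖ ^ 2) := by
  have h := hasSum_inner_coeff u u
  rw [inner_self_eq_norm_sq_to_K] at h
  simp only [Complex.conj_mul'] at h
  have h' : HasSum (fun m => ((‖coeff b m u‖ ^ 2 : ℝ) : ℂ)) ((‖u‖ ^ 2 : ℝ) : ℂ) := by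
    push_cast
    exact h
  exact Complex.hasSum_ofReal.1 h'

theorem hasSum_sum_norm_coeff_sq (v : L2Vec b) :
    HasSum (fun m => ∑ i, ‖coeff b m (v i)‖ ^ 2) (‖v‖ ^ 2) := by
  rw [PiLp.norm_sq_eq_of_L2]
  exact hasSum_sum fun i _ => hasSum_norm_coeff_sq (v i)

/-- Parseval's identity for `u` and the conjugate of `ψ`. -/
theorem hasSum_pairing (u : L2 b) {ψ : Plane → ℂ} (hψ : Continuous ψ) :
    HasSum (fun m => coeff b m u * pairing b (modeL2 b m) ψ) (pairing b u ψ) := by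
  have hc : Continuous fun x => starRingEnd ℂ (ψ x) := Complex.continuous_conj.comp hψ
  have h := (fourierHilbertBasis b).hasSum_inner_mul_inner (toL2 b _ hc) u
  simp only [fourierHilbertBasis_apply, inner_toL2, Complex.conj_conj] at h
  simpa only [coeff_apply, mul_comm] using h

/-- The integral of `φ (x + t e)` over the cell does not depend on `t`; differentiate under the
integral sign at `t = 0`. -/
theorem setIntegral_partialDeriv {φ : Plane → ℂ} (hφ : IsTest b φ) (j : Fin 2) :
    ∫ x in cell b, partialDeriv j φ x = 0 := by
  set e : Plane := EuclideanSpace.single j 1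
  have hmeas : MeasurableSet (cell b) := ZSpan.fundamentalDomain_measurableSet b
  obtain ⟨R, hR⟩ := (ZSpan.fundamentalDomain_isBounded b).exists_norm_le
  obtain ⟨C, hC⟩ := (isCompact_closedBall (0 : Plane)
    (R + ‖e‖)).exists_bound_of_continuousOn (hφ.continuous_partialDeriv j).continuousOn
  have hd : ∀ x t, HasDerivAt (fun t : ℝ => φ (x + t • e)) (partialDeriv j φ (x + t • e)) t := by
    intro x t
    have h1 : HasDerivAt (fun t : ℝ => x + t • e) e t := by
      simpa using ((hasDerivAt_id t).smul_const e).const_add x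
    exact ((hφ.1.differentiable (by simp)) (x + t • e)).hasFDerivAt.comp_hasDerivAt t h1
  have hcont : ∀ t : ℝ, Continuous fun x => φ (x + t • e) := fun t =>
    hφ.continuous.comp (continuous_id.add continuous_const)
  have key := (hasDerivAt_integral_of_dominated_loc_of_deriv_le (μ := cellMeasure b)
    (F := fun (t : ℝ) x => φ (x + t • e)) (F' := fun (t : ℝ) x => partialDeriv j φ (x + t • e))
    (x₀ := 0) (s := Metric.ball 0 1) (bound := fun _ => C) (Metric.ball_mem_nhds _ one_pos)
    (Eventually.of_forall fun t => (hcont t).aestronglyMeasurable)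
    ((memLp_of_continuous b (hcont 0)).integrable (by norm_num))
    ((hφ.continuous_partialDeriv j).comp
      (continuous_id.add continuous_const)).aestronglyMeasurable
    ((ae_restrict_iff' hmeas).2 (Eventually.of_forall fun x hx t ht => hC _ ?_))
    (integrable_const C)
    (Eventually.of_forall fun x t _ => hd x t)).2
  · have hconst : (fun t : ℝ => ∫ x in cell b, φ (x + t • e)) = fun _ => ∫ x in cell b, φ x :=
      funext fun t => setIntegral_cell_add b hφ.2 (t • e)
    rw [hconst] at key
    have := key.unique (hasDerivAt_const _ _)
    simpa using this
  · rw [mem_closedBall_zero_iff]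
    have ht' : ‖t‖ ≤ 1 := (mem_ball_zero_iff.1 ht).le
    refine (norm_add_le _ _).trans (add_le_add (hR x hx) ?_)
    rw [norm_smul]
    exact mul_le_of_le_one_left (norm_nonneg _) ht'

theorem IsTest.mul {φ ψ : Plane → ℂ} (hφ : IsTest b φ) (hψ : IsTest b ψ) :
    IsTest b fun x => φ x * ψ x :=
  ⟨hφ.1.mul hψ.1, fun k hk x => by simp only [hφ.2 k hk, hψ.2 k hk]⟩

theorem partialDeriv_mul {φ ψ : Plane → ℂ} (hφ : IsTest b φ) (hψ : IsTest b ψ) (j : Fin 2)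
    (x : Plane) : partialDeriv j (fun x => φ x * ψ x) x =
      partialDeriv j φ x * ψ x + φ x * partialDeriv j ψ x := by
  unfold partialDeriv
  rw [fderiv_fun_mul (hφ.1.differentiable (by simp) x) (hψ.1.differentiable (by simp) x)]
  simp
  ring

/-- Integration by parts: periodicity leaves no boundary term. -/
theorem setIntegral_mode_mul_partialDeriv (m : Fin 2 → ℤ) {φ : Plane → ℂ} (hφ : IsTest b φ)
    (j : Fin 2) : ∫ x in cell b, mode b m x * partialDeriv j φ x =
      -(Complex.I * (frequency b m j : ℂ) * ∫ x in cell b, mode b m x * φ x) := by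
  have hm := isTest_mode b m
  have h := setIntegral_partialDeriv (hm.mul hφ) j
  have hi : ∀ f : Plane → ℂ, Continuous f → Integrable f (cellMeasure b) := fun f hf =>
    (memLp_of_continuous b hf).integrable (by norm_num)
  simp only [partialDeriv_mul hm hφ, partialDeriv_mode] at h
  rw [integral_add (hi (fun x => Complex.I * (frequency b m j : ℂ) * mode b m x * φ x)
      ((continuous_const.mul hm.continuous).mul hφ.continuous))
    (hi (fun x => mode b m x * partialDeriv j φ x)
      (hm.continuous.mul (hφ.continuous_partialDeriv j)))] at h
  simp only [mul_assoc, integral_const_mul] at h ⊢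
  linear_combination h

variable (b) in
/-- The wave vector `(ξ' + g, β)` belonging to the plane wave of frequency `g`. -/
def modeVector (ξ : Plane) (β : ℝ) (m : Fin 2 → ℤ) : Fin 3 → ℝ :=
  waveVector (ξ + frequency b m) β

theorem pairing_modeL2 (m : Fin 2 → ℤ) (ψ : Plane → ℂ) :
    pairing b (modeL2 b m) ψ =
      (((Real.sqrt (area b))⁻¹ : ℝ) : ℂ) * ∫ x in cell b, mode b m x * ψ x := by
  rw [modeL2, pairing_smul, pairing_toL2]

theorem pairing_modeL2_nablaTranspose (ξ : Plane) (β : ℝ) (j : Fin 3) (m : Fin 2 → ℤ)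
    {φ : Plane → ℂ} (hφ : IsTest b φ) :
    pairing b (modeL2 b m) (nablaTranspose ξ β j φ) =
      Complex.I * (modeVector b ξ β m j : ℂ) * pairing b (modeL2 b m) φ := by
  have hm := isTest_mode b m
  have hi : ∀ f : Plane → ℂ, Continuous f → Integrable f (cellMeasure b) := fun f hf =>
    (memLp_of_continuous b hf).integrable (by norm_num)
  have key : ∀ (c : ℝ) (k : Fin 2), ∫ x in cell b, mode b m x *
      (-partialDeriv k φ x + Complex.I * (c : ℂ) * φ x) =
      Complex.I * ((c + frequency b m k : ℝ) : ℂ) * ∫ x in cell b, mode b m x * φ x := by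
    intro c k
    have h1 : ∀ x, mode b m x * (-partialDeriv k φ x + Complex.I * (c : ℂ) * φ x) =
        -(mode b m x * partialDeriv k φ x) + Complex.I * (c : ℂ) * (mode b m x * φ x) := by
      intro x
      ring
    simp only [h1]
    rw [integral_add (hi (fun x => -(mode b m x * partialDeriv k φ x))
        (hm.continuous.mul (hφ.continuous_partialDeriv k)).neg)
      (hi (fun x => Complex.I * (c : ℂ) * (mode b m x * φ x))
        (continuous_const.mul (hm.continuous.mul hφ.continuous))), integral_neg,
      setIntegral_mode_mul_partialDeriv m hφ, integral_const_mul]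
    push_cast
    ring
  rw [pairing_modeL2, pairing_modeL2, mul_left_comm]
  congr 1
  fin_cases j
  · exact key (ξ 0) 0
  · exact key (ξ 1) 1
  · change ∫ x in cell b, mode b m x * (-0 + Complex.I * (β : ℂ) * φ x) =
      Complex.I * (β : ℂ) * _
    rw [← integral_const_mul]
    congr 1
    ext x
    ring

theorem hasSum_nablaPairing (ξ : Plane) (β : ℝ) (j : Fin 3) (u : L2 b) {φ : Plane → ℂ}
    (hφ : IsTest b φ) :
    HasSum (fun m => Complex.I * (modeVector b ξ β m j : ℂ) * coeff b m u *
      pairing b (modeL2 b m) φ) (nablaPairing b ξ β j u φ) := by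
  have h := hasSum_pairing u (hφ.continuous_nablaTranspose ξ β j)
  simp only [pairing_modeL2_nablaTranspose ξ β j _ hφ] at h
  rw [nablaPairing]
  convert! h using 2
  ring

theorem pairing_mode_neg_eq_coeff (u : L2 b) (m : Fin 2 → ℤ) :
    pairing b u (mode b (-m)) = (Real.sqrt (area b) : ℂ) * coeff b m u :=
  pairing_mode_neg b u m

theorem nablaPairing_mode_neg (ξ : Plane) (β : ℝ) (j : Fin 3) (u : L2 b) (m : Fin 2 → ℤ) :
    nablaPairing b ξ β j u (mode b (-m)) = (Real.sqrt (area b) : ℂ) *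
      (Complex.I * (modeVector b ξ β m j : ℂ) * coeff b m u) := by
  have h1 : nablaTranspose ξ β j (mode b (-m)) = fun x =>
      Complex.I * (modeVector b ξ β m j : ℂ) * mode b (-m) x := by
    ext x
    fin_cases j
    · simp [nablaTranspose, gradient, modeVector, waveVector, partialDeriv_mode, frequency_neg]
      ring
    · simp [nablaTranspose, gradient, modeVector, waveVector, partialDeriv_mode, frequency_neg]
      ring
    · simp [nablaTranspose, gradient, modeVector, waveVector]
  rw [nablaPairing, h1, mul_left_comm, ← pairing_mode_neg_eq_coeff]
  unfold pairing
  rw [← integral_const_mul]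
  congr 1
  ext x
  ring

theorem sqrt_area_ne_zero : (Real.sqrt (area b) : ℂ) ≠ 0 :=
  Complex.ofReal_ne_zero.2 (Real.sqrt_pos.2 (area_pos b)).ne'

/-- Plane waves are test functions, so the weak identity can be evaluated on them. Conversely, both
sides of the weak identity expand along the Fourier basis for any test function, and the expansions
agree term by term. -/
theorem isWeakCurl_iff {ξ : Plane} {β : ℝ} {v w : L2Vec b} :
    IsWeakCurl b ξ β v w ↔ ∀ m i, coeff b m (w i) =
      Complex.I * ((modeVector b ξ β m (i + 1) : ℂ) * coeff b m (v (i + 2)) -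
        (modeVector b ξ β m (i + 2) : ℂ) * coeff b m (v (i + 1))) := by
  constructor
  · intro h m i
    have h1 := h _ (isTest_mode b (-m)) i
    rw [pairing_mode_neg_eq_coeff, nablaPairing_mode_neg, nablaPairing_mode_neg, ← mul_sub] at h1
    rw [mul_left_cancel₀ sqrt_area_ne_zero h1]
    ring
  · intro h φ hφ i
    have h1 := hasSum_pairing (w i) hφ.continuous
    have h2 := (hasSum_nablaPairing ξ β (i + 1) (v (i + 2)) hφ).sub
      (hasSum_nablaPairing ξ β (i + 2) (v (i + 1)) hφ)
    refine h1.unique ?_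
    convert! h2 using 2 with m
    rw [h]
    ring

theorem isDivFree_iff {ξ : Plane} {β : ℝ} {v : L2Vec b} :
    IsDivFree b ξ β v ↔ ∀ m, ∑ j, (modeVector b ξ β m j : ℂ) * coeff b m (v j) = 0 := by
  constructor
  · intro h m
    have h1 := h _ (isTest_mode b (-m))
    simp only [nablaPairing_mode_neg, mul_assoc] at h1
    rw [← Finset.mul_sum, ← Finset.mul_sum] at h1
    exact (mul_eq_zero.1 ((mul_eq_zero.1 h1).resolve_left sqrt_area_ne_zero)).resolve_left
      Complex.I_ne_zero
  · intro h φ hφ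
    have h1 := hasSum_sum fun j (_ : j ∈ Finset.univ) => hasSum_nablaPairing ξ β j (v j) hφ
    refine h1.unique ?_
    convert! hasSum_zero using 2 with m
    rw [← Finset.sum_mul]
    simp only [mul_assoc]
    rw [← Finset.mul_sum, h m, mul_zero, zero_mul]

theorem nablaTranspose_zero_castSucc (j : Fin 2) (φ : Plane → ℂ) :
    nablaTranspose 0 0 j.castSucc φ = fun x => -partialDeriv j φ x := by
  ext x
  fin_cases j <;> simp [nablaTranspose, gradient, waveVector]

theorem modeVector_zero_castSucc (m : Fin 2 → ℤ) (j : Fin 2) :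
    modeVector b 0 0 m j.castSucc = frequency b m j := by
  fin_cases j <;> simp [modeVector, waveVector]

/-- The weak derivatives are the first two components of `∇'` at wave vector zero, so the multiplier
calculus applies unchanged. -/
theorem isWeakPartial_iff {j : Fin 2} {u g : L2 b} :
    IsWeakPartial b j u g ↔
      ∀ m, coeff b m g = Complex.I * (frequency b m j : ℂ) * coeff b m u := by
  have e : ∀ φ, nablaPairing b 0 0 j.castSucc u φ = -pairing b u (partialDeriv j φ) := by
    intro φ
    rw [nablaPairing, nablaTranspose_zero_castSucc]
    unfold pairing
    rw [← integral_neg]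
    simp only [mul_neg]
  constructor
  · intro h m
    have h1 := nablaPairing_mode_neg 0 0 j.castSucc u m
    rw [e, h _ (isTest_mode b (-m)), neg_neg, pairing_mode_neg_eq_coeff, modeVector_zero_castSucc] at h1
    exact mul_left_cancel₀ sqrt_area_ne_zero h1
  · intro h φ hφ
    rw [← neg_eq_iff_eq_neg, ← e]
    refine (hasSum_nablaPairing 0 0 j.castSucc u hφ).unique ?_
    have h1 := hasSum_pairing g hφ.continuous
    simp only [h] at h1
    simpa only [modeVector_zero_castSucc] using h1

end Coefficients

/-! ### `ℍ¹` regularity and coercivity -/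

section Regularity

variable {b : Module.Basis (Fin 2) ℝ Plane} {ξ : Plane} {β : ℝ}

theorem sq_waveVector (η : Plane) (β : ℝ) :
    ∑ i, waveVector η β i ^ 2 = ‖η‖ ^ 2 + β ^ 2 := by
  rw [EuclideanSpace.real_norm_sq_eq, Fin.sum_univ_two, Fin.sum_univ_three]
  simp [waveVector]

/-- Lagrange's identity for a real and a complex vector. -/
theorem sum_norm_cross_sq_add (k : Fin 3 → ℝ) (z : Fin 3 → ℂ) :
    ∑ i, ‖(k (i + 1) : ℂ) * z (i + 2) - (k (i + 2) : ℂ) * z (i + 1)‖ ^ 2 +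
      ‖∑ i, (k i : ℂ) * z i‖ ^ 2 = (∑ i, k i ^ 2) * ∑ i, ‖z i‖ ^ 2 := by
  simp only [Fin.sum_univ_three, Complex.sq_norm, Complex.normSq_apply]
  simp
  ring

/-- Divergence-freeness kills the scalar product in Lagrange's identity, so the curl has the full
size of the wave vector. Both the regularity and the compactness estimates rest on this. -/
theorem sum_norm_coeff_curl_sq {v w : L2Vec b} (hw : IsWeakCurl b ξ β v w)
    (hv : IsDivFree b ξ β v) (m : Fin 2 → ℤ) :
    ∑ i, ‖coeff b m (w i)‖ ^ 2 =
      (‖ξ + frequency b m‖ ^ 2 + β ^ 2) * ∑ i, ‖coeff b m (v i)‖ ^ 2 := by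
  have h := sum_norm_cross_sq_add (modeVector b ξ β m) (fun i => coeff b m (v i))
  rw [isDivFree_iff.1 hv m, norm_zero, zero_pow two_ne_zero, add_zero, modeVector,
    sq_waveVector] at h
  rw [← h]
  refine Finset.sum_congr rfl fun i _ => ?_
  rw [isWeakCurl_iff.1 hw m i, norm_mul, Complex.norm_I, one_mul]
  rfl

theorem norm_frequency_sq_le (m : Fin 2 → ℤ) :
    ‖frequency b m‖ ^ 2 ≤ 2 * ‖ξ + frequency b m‖ ^ 2 + 2 * ‖ξ‖ ^ 2 := by
  have h : ‖frequency b m‖ ≤ ‖ξ + frequency b m‖ + ‖ξ‖ := by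
    simpa using norm_sub_le (ξ + frequency b m) ξ
  nlinarith [norm_nonneg (frequency b m), sq_nonneg (‖ξ + frequency b m‖ - ‖ξ‖),
    norm_nonneg (ξ + frequency b m), norm_nonneg ξ]

theorem norm_frequency_sq (m : Fin 2 → ℤ) :
    ‖frequency b m‖ ^ 2 = ∑ j, frequency b m j ^ 2 := EuclideanSpace.real_norm_sq_eq _

theorem summable_frequency_sq_mul {v w : L2Vec b} (hw : IsWeakCurl b ξ β v w)
    (hv : IsDivFree b ξ β v) :
    Summable fun m => ‖frequency b m‖ ^ 2 * ∑ i, ‖coeff b m (v i)‖ ^ 2 := by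
  have h1 := (hasSum_sum_norm_coeff_sq w).summable.mul_left 2
  have h2 := (hasSum_sum_norm_coeff_sq v).summable.mul_left (2 * ‖ξ‖ ^ 2)
  refine Summable.of_nonneg_of_le (fun m => by positivity) (fun m => ?_) (h1.add h2)
  rw [sum_norm_coeff_curl_sq hw hv m]
  have h3 : 0 ≤ ∑ i, ‖coeff b m (v i)‖ ^ 2 := by positivity
  have h4 := mul_le_mul_of_nonneg_right (norm_frequency_sq_le (ξ := ξ) (b := b) m) h3
  nlinarith [mul_nonneg (sq_nonneg β) h3]

/-- The candidate coefficients `i g_j v̂_i` are square summable, and Riesz–Fischer turns them into a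
weak derivative. -/
theorem variationalSpace_le_sobolevH1 : variationalSpace b ξ β ≤ sobolevH1 b := by
  rintro v ⟨⟨w, hw⟩, hv⟩ i j
  obtain ⟨g, hg⟩ := exists_coeff_eq (b := b)
    (c := fun m => Complex.I * (frequency b m j : ℂ) * coeff b m (v i)) (by
      refine Summable.of_nonneg_of_le (fun m => by positivity) (fun m => ?_)
        (summable_frequency_sq_mul hw hv)
      rw [norm_mul, norm_mul, Complex.norm_I, one_mul, Complex.norm_real, mul_pow, Real.norm_eq_abs,
        sq_abs]
      refine mul_le_mul ?_ ?_ (by positivity) (by positivity)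
      · rw [norm_frequency_sq]
        exact Finset.single_le_sum (f := fun j => frequency b m j ^ 2)
          (fun j _ => sq_nonneg _) (Finset.mem_univ j)
      · exact Finset.single_le_sum (f := fun i => ‖coeff b m (v i)‖ ^ 2)
          (fun i _ => sq_nonneg _) (Finset.mem_univ i))
  exact ⟨g, isWeakPartial_iff.2 hg⟩

theorem isWeakPartial_weakPartial {j : Fin 2} {u : L2 b} (h : ∃ g, IsWeakPartial b j u g) :
    IsWeakPartial b j u (weakPartial b j u) := by
  rw [weakPartial, dif_pos h]
  exact h.choose_spec

theorem isWeakCurl_curl {v : L2Vec b} (h : ∃ w, IsWeakCurl b ξ β v w) :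
    IsWeakCurl b ξ β v (curl b ξ β v) := by
  rw [curl, dif_pos h]
  exact h.choose_spec

theorem hasSum_h1Norm_sq {v : L2Vec b} (hv : v ∈ sobolevH1 b) :
    HasSum (fun m => (1 + ‖frequency b m‖ ^ 2) * ∑ i, ‖coeff b m (v i)‖ ^ 2)
      (h1Norm b v ^ 2) := by
  rw [h1Norm, Real.sq_sqrt (by positivity)]
  have h1 : HasSum (fun m => ∑ i, ∑ j, ‖coeff b m (weakPartial b j (v i))‖ ^ 2)
      (∑ i : Fin 3, ∑ j : Fin 2, ‖weakPartial b j (v i)‖ ^ 2) :=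
    hasSum_sum fun i _ => hasSum_sum fun j _ => hasSum_norm_coeff_sq _
  convert! (hasSum_sum_norm_coeff_sq v).add h1 using 2 with m
  rw [add_mul, one_mul, Finset.mul_sum]
  congr 1
  refine Finset.sum_congr rfl fun i _ => ?_
  rw [norm_frequency_sq, Finset.sum_mul]
  refine Finset.sum_congr rfl fun j _ => ?_
  rw [isWeakPartial_iff.1 (isWeakPartial_weakPartial (hv i j)) m, norm_mul, norm_mul,
    Complex.norm_I, one_mul, Complex.norm_real, mul_pow, Real.norm_eq_abs, sq_abs]

/-- The inequality holds mode by mode: half of `1 + |g|²` is at most `|ξ + g|² + |ξ|² + 1/2`, which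
leaves room in the constant `3|ξ|² + 1`. -/
theorem h1Norm_sq_le {v w : L2Vec b} (hw : IsWeakCurl b ξ β v w) (hv : IsDivFree b ξ β v) :
    (1 / 2) * h1Norm b v ^ 2 + β ^ 2 * ‖v‖ ^ 2 ≤ ‖w‖ ^ 2 + (3 * ‖ξ‖ ^ 2 + 1) * ‖v‖ ^ 2 := by
  have h1 := ((hasSum_h1Norm_sq (variationalSpace_le_sobolevH1
    (show v ∈ variationalSpace b ξ β from ⟨⟨w, hw⟩, hv⟩))).mul_left (1 / 2)).add
    ((hasSum_sum_norm_coeff_sq v).mul_left (β ^ 2))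
  have h2 := (hasSum_sum_norm_coeff_sq w).add
    ((hasSum_sum_norm_coeff_sq v).mul_left (3 * ‖ξ‖ ^ 2 + 1))
  refine hasSum_le (fun m => ?_) h1 h2
  rw [sum_norm_coeff_curl_sq hw hv m]
  have h3 : 0 ≤ ∑ i, ‖coeff b m (v i)‖ ^ 2 := by positivity
  have h4 := norm_frequency_sq_le (ξ := ξ) (b := b) m
  have h5 : 1 / 2 * (1 + ‖frequency b m‖ ^ 2) + β ^ 2 ≤
      ‖ξ + frequency b m‖ ^ 2 + β ^ 2 + (3 * ‖ξ‖ ^ 2 + 1) := by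
    nlinarith [sq_nonneg ‖ξ‖]
  have h6 := mul_le_mul_of_nonneg_right h5 h3
  linarith

theorem ae_norm_le_toReal_eLpNorm_top {α F : Type*} [MeasurableSpace α] [NormedAddCommGroup F]
    {μ : Measure α} {f : α → F} (hf : MemLp f ⊤ μ) :
    ∀ᵐ x ∂μ, ‖f x‖ ≤ (eLpNorm f ⊤ μ).toReal := by
  filter_upwards [ae_le_eLpNormEssSup (f := f) (μ := μ)] with x hx
  rw [← toReal_enorm]
  exact ENNReal.toReal_mono hf.2.ne (by rwa [eLpNorm_exponent_top])

/-- The hypotheses on the index of refraction that are used below. -/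
structure IsIndex (b : Module.Basis (Fin 2) ℝ Plane) (n : Plane → ℝ) : Prop where
  memLp : MemLp n ⊤ (cellMeasure b)
  memLp_inv : MemLp (fun x => (n x)⁻¹) ⊤ (cellMeasure b)
  pos : ∀ᵐ x ∂cellMeasure b, 0 < n x

theorem isIndex_refractiveIndex (b : Module.Basis (Fin 2) ℝ Plane) {ε₀ : ℝ} (hε₀ : 0 < ε₀)
    {ε : Plane → ℝ} (hpos : ∀ᵐ x, 0 < ε x) (hbdd : MemLp ε ⊤ volume)
    (hinv : MemLp (fun x => (ε x)⁻¹) ⊤ volume) : IsIndex b (refractiveIndex ε₀ ε) := by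
  -- One bound serves both `n = √(ε ε₀⁻¹)` and `n⁻¹ = √(ε⁻¹ ε₀)`.
  have key : ∀ (f : Plane → ℝ) (c : ℝ), 0 ≤ c → MemLp f ⊤ volume →
      MemLp (fun x => Real.sqrt (f x * c)) ⊤ (cellMeasure b) := by
    intro f c hc hf
    refine MemLp.mono_measure Measure.restrict_le_self (memLp_top_of_bound
      (Real.continuous_sqrt.comp_aestronglyMeasurable (hf.1.mul_const c))
      (Real.sqrt ((eLpNorm f ⊤ volume).toReal * c)) ?_)
    filter_upwards [ae_norm_le_toReal_eLpNorm_top hf] with x hx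
    rw [Real.norm_of_nonneg (Real.sqrt_nonneg _)]
    exact Real.sqrt_le_sqrt (mul_le_mul_of_nonneg_right ((le_abs_self _).trans hx) hc)
  refine ⟨key ε ε₀⁻¹ (inv_nonneg.2 hε₀.le) hbdd, ?_, ?_⟩
  · convert! key _ ε₀ hε₀.le hinv using 2 with x
    rw [refractiveIndex, ← Real.sqrt_inv, inv_div, div_eq_mul_inv, mul_comm]
  · filter_upwards [ae_restrict_of_ae hpos] with x hx
    exact Real.sqrt_pos.2 (div_pos hx hε₀)

theorem norm_L2_sq (u : L2 b) : ‖u‖ ^ 2 = ∫ x in cell b, ‖u x‖ ^ 2 := by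
  have h : ((‖u‖ ^ 2 : ℝ) : ℂ) = ((∫ x in cell b, ‖u x‖ ^ 2 : ℝ) : ℂ) := by
    rw [← integral_complex_ofReal]
    have h1 : inner ℂ u u = _ := L2.inner_def u u
    rw [inner_self_eq_norm_sq_to_K] at h1
    push_cast
    refine h1.trans (integral_congr_ae (Eventually.of_forall fun x => ?_))
    simp only [inner_self_eq_norm_sq_to_K]
    simp
  exact_mod_cast h

theorem integrable_norm_sq (u : L2 b) : Integrable (fun x => ‖u x‖ ^ 2) (cellMeasure b) :=
  (memLp_two_iff_integrable_sq_norm (Lp.aestronglyMeasurable u)).1 (Lp.memLp u)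

theorem form_self (n : Plane → ℝ) (v : L2Vec b) :
    form b n ξ β v v =
      ((∫ x in cell b, 1 / n x ^ 2 * ∑ i, ‖curl b ξ β v i x‖ ^ 2 : ℝ) : ℂ) := by
  rw [form, ← integral_complex_ofReal]
  congr 1
  ext x
  simp only [Complex.mul_conj']
  push_cast
  rfl

theorem norm_curl_sq_le_form {n : Plane → ℝ} (hn : IsIndex b n) (v : L2Vec b) :
    ‖curl b ξ β v‖ ^ 2 ≤ indexSupNorm b n ^ 2 * (form b n ξ β v v).re := by
  rw [form_self, Complex.ofReal_re, PiLp.norm_sq_eq_of_L2]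
  simp only [norm_L2_sq]
  rw [← integral_finsetSum _ fun i _ => integrable_norm_sq _, ← integral_const_mul]
  have hint : Integrable (fun x => ∑ i, ‖curl b ξ β v i x‖ ^ 2) (cellMeasure b) :=
    integrable_finsetSum _ fun i _ => integrable_norm_sq _
  -- Boundedness of `n⁻¹` makes the integrand of the form integrable; otherwise its Bochner integral
  -- would be `0` by convention and could not bound anything from above.
  have hn2 : ∀ᵐ x ∂cellMeasure b, ‖1 / n x ^ 2‖ ≤
      (eLpNorm (fun x => (n x)⁻¹) ⊤ (cellMeasure b)).toReal ^ 2 := by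
    filter_upwards [ae_norm_le_toReal_eLpNorm_top hn.memLp_inv] with x hx
    rw [one_div, ← inv_pow, norm_pow]
    exact pow_le_pow_left₀ (norm_nonneg _) hx 2
  have hmeas : AEStronglyMeasurable (fun x => 1 / n x ^ 2) (cellMeasure b) := by
    refine (hn.memLp_inv.1.pow 2).congr (Eventually.of_forall fun x => ?_)
    simp
  refine integral_mono_ae hint ((hint.bdd_mul hmeas hn2).const_mul _) ?_
  filter_upwards [ae_norm_le_toReal_eLpNorm_top hn.memLp, hn.pos] with x hx hx0
  have h1 : n x ≤ indexSupNorm b n := (le_abs_self _).trans hx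
  have h2 : 0 ≤ ∑ i, ‖curl b ξ β v i x‖ ^ 2 := by positivity
  change _ ≤ indexSupNorm b n ^ 2 * (1 / n x ^ 2 * _)
  rw [← mul_assoc, mul_one_div]
  refine le_mul_of_one_le_left h2 ((one_le_div (by positivity)).2 ?_)
  exact pow_le_pow_left₀ hx0.le h1 2

end Regularity

/-! ### Multiplication operators on `L²(Q')` -/

section Multiplication

variable {b : Module.Basis (Fin 2) ℝ Plane} {a c : Plane → ℝ}

/-- Multiplication by a bounded real function in `L²(Q')`. -/
def mulOp (ha : MemLp a ⊤ (cellMeasure b)) : L2 b →L[ℂ] L2 b :=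
  (ContinuousLinearMap.mul ℂ ℂ).holderL (cellMeasure b) ⊤ 2 2
    (MemLp.toLp (fun x => (a x : ℂ)) ha.ofReal)

theorem coeFn_mulOp (ha : MemLp a ⊤ (cellMeasure b)) (u : L2 b) :
    mulOp ha u =ᵐ[cellMeasure b] fun x => (a x : ℂ) * u x := by
  filter_upwards [(ContinuousLinearMap.mul ℂ ℂ).coeFn_holder (r := 2)
    (MemLp.toLp (fun x => (a x : ℂ)) ha.ofReal) u,
    MemLp.coeFn_toLp (f := fun x => (a x : ℂ)) ha.ofReal] with x h1 h2
  rw [mulOp, ContinuousLinearMap.holderL_apply_apply, h1, h2]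
  rfl

theorem inner_mulOp_left (ha : MemLp a ⊤ (cellMeasure b)) (u v : L2 b) :
    inner ℂ (mulOp ha u) v = inner ℂ u (mulOp ha v) := by
  rw [L2.inner_def, L2.inner_def]
  refine integral_congr_ae ?_
  filter_upwards [coeFn_mulOp ha u, coeFn_mulOp ha v] with x h1 h2
  rw [h1, h2]
  simp
  ring

theorem mulOp_mulOp_eq_self (ha : MemLp a ⊤ (cellMeasure b)) (hc : MemLp c ⊤ (cellMeasure b))
    (hac : ∀ᵐ x ∂cellMeasure b, a x * c x = 1) (u : L2 b) : mulOp ha (mulOp hc u) = u := by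
  refine Lp.ext ?_
  filter_upwards [coeFn_mulOp ha (mulOp hc u), coeFn_mulOp hc u, hac] with x h1 h2 h3
  rw [h1, h2, ← mul_assoc, ← Complex.ofReal_mul, h3, Complex.ofReal_one, one_mul]

end Multiplication

/-! ### Vector plane waves, symmetry of the curl, and frequency truncation -/

section PlaneWaves

variable {b : Module.Basis (Fin 2) ℝ Plane} {ξ : Plane} {β : ℝ}

variable (b) in
/-- The vector field with amplitude `c` carried by the normalized plane wave of index `m`. -/
def planeWave (m : Fin 2 → ℤ) : (Fin 3 → ℂ) →L[ℂ] L2Vec b :=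
  LinearMap.toContinuousLinearMap
    { toFun := fun c => WithLp.toLp 2 fun i => c i • modeL2 b m
      map_add' := fun c d => by
        ext1 i
        simp [add_smul]
      map_smul' := fun r c => by
        ext1 i
        simp [mul_smul] }

theorem planeWave_apply (m : Fin 2 → ℤ) (c : Fin 3 → ℂ) (i : Fin 3) :
    planeWave b m c i = c i • modeL2 b m := rfl

theorem coeff_planeWave (m l : Fin 2 → ℤ) (c : Fin 3 → ℂ) (i : Fin 3) :
    coeff b l (planeWave b m c i) = if l = m then c i else 0 := by
  rw [planeWave_apply, map_smul, coeff_apply, orthonormal_iff_ite.1 (orthonormal_modeL2 b) l m]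
  simp

theorem inner_planeWave (m : Fin 2 → ℤ) (c : Fin 3 → ℂ) (v : L2Vec b) :
    inner ℂ (planeWave b m c) v = ∑ i, starRingEnd ℂ (c i) * coeff b m (v i) := by
  rw [PiLp.inner_apply]
  refine Finset.sum_congr rfl fun i _ => ?_
  rw [planeWave_apply, inner_smul_left, coeff_apply]

/-- The vector `i k × z`. -/
def iCross (k : Fin 3 → ℝ) (z : Fin 3 → ℂ) : Fin 3 → ℂ := fun i =>
  Complex.I * ((k (i + 1) : ℂ) * z (i + 2) - (k (i + 2) : ℂ) * z (i + 1))

theorem sum_mul_iCross (k : Fin 3 → ℝ) (z : Fin 3 → ℂ) : ∑ i, (k i : ℂ) * iCross k z i = 0 := by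
  simp [Fin.sum_univ_three, iCross]
  ring

/-- For real `k` the matrix of `k ×` is real antisymmetric, so `i k ×` is Hermitian. -/
theorem sum_conj_iCross_mul (k : Fin 3 → ℝ) (y z : Fin 3 → ℂ) :
    ∑ i, starRingEnd ℂ (iCross k y i) * z i = ∑ i, starRingEnd ℂ (y i) * iCross k z i := by
  simp [Fin.sum_univ_three, iCross]
  ring

theorem isWeakCurl_planeWave (m : Fin 2 → ℤ) (c : Fin 3 → ℂ) :
    IsWeakCurl b ξ β (planeWave b m c) (planeWave b m (iCross (modeVector b ξ β m) c)) := by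
  rw [isWeakCurl_iff]
  intro l i
  simp only [coeff_planeWave]
  split_ifs with h
  · rw [h]
    rfl
  · simp

theorem isDivFree_planeWave {m : Fin 2 → ℤ} {c : Fin 3 → ℂ}
    (hc : ∑ i, (modeVector b ξ β m i : ℂ) * c i = 0) : IsDivFree b ξ β (planeWave b m c) := by
  rw [isDivFree_iff]
  intro l
  simp only [coeff_planeWave]
  split_ifs with h
  · rw [h, hc]
  · simp

theorem hasSum_inner_sum_coeff (u v : L2Vec b) :
    HasSum (fun m => ∑ i, starRingEnd ℂ (coeff b m (u i)) * coeff b m (v i)) (inner ℂ u v) := by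
  rw [PiLp.inner_apply]
  exact hasSum_sum fun i _ => hasSum_inner_coeff (u i) (v i)

/-- Symmetry of the curl follows from that of `i k ×` on each mode; the torus has no boundary, so no
boundary condition enters. -/
theorem inner_curl_left {v w u f : L2Vec b} (hw : IsWeakCurl b ξ β v w)
    (hf : IsWeakCurl b ξ β u f) : inner ℂ w u = inner ℂ v f := by
  refine (hasSum_inner_sum_coeff w u).unique ?_
  convert! hasSum_inner_sum_coeff v f using 2 with m
  simp only [isWeakCurl_iff.1 hw m, isWeakCurl_iff.1 hf m]
  exact sum_conj_iCross_mul (modeVector b ξ β m) (fun i => coeff b m (v i))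
    (fun i => coeff b m (u i))

variable (b) in
/-- The projection onto the plane waves with index in `S`. -/
def lowModes (S : Finset (Fin 2 → ℤ)) : L2Vec b →L[ℂ] L2Vec b :=
  ∑ m ∈ S, planeWave b m ∘L
    ContinuousLinearMap.pi fun i => coeff b m ∘L PiLp.proj 2 (fun _ : Fin 3 => L2 b) i

theorem isCompactOperator_lowModes (S : Finset (Fin 2 → ℤ)) :
    IsCompactOperator (lowModes b S) := by
  refine (compactOperator (RingHom.id ℂ) (L2Vec b) (L2Vec b)).sum_mem (t := S)
    (f := fun m => planeWave b m ∘L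
      ContinuousLinearMap.pi fun i => coeff b m ∘L PiLp.proj 2 (fun _ : Fin 3 => L2 b) i)
    fun m _ => ?_
  exact (isCompactOperator_of_locallyCompactSpace_rng
    (planeWave b m)).comp_clm _

theorem coeff_lowModes (S : Finset (Fin 2 → ℤ)) (v : L2Vec b) (l : Fin 2 → ℤ) (i : Fin 3) :
    coeff b l (lowModes b S v i) = if l ∈ S then coeff b l (v i) else 0 := by
  have h : lowModes b S v i = ∑ m ∈ S, planeWave b m (fun i => coeff b m (v i)) i := by
    rw [lowModes, _root_.sum_apply, WithLp.ofLp_sum, Finset.sum_apply]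
    rfl
  rw [h, map_sum]
  simp only [coeff_planeWave]
  rw [Finset.sum_ite_eq]

/-- A quantitative Rellich theorem: on the discarded modes `R² ≤ |g|² ≤ 2|ξ + g|² + 2|ξ|²`, and the
curl accounts for the factor `|ξ + g|²`. -/
theorem norm_sub_lowModes_sq_le {v w : L2Vec b} (hw : IsWeakCurl b ξ β v w)
    (hv : IsDivFree b ξ β v) {S : Finset (Fin 2 → ℤ)} {R : ℝ} (hR : 0 ≤ R)
    (hS : ∀ m ∉ S, R ≤ ‖frequency b m‖) :
    R ^ 2 * ‖v - lowModes b S v‖ ^ 2 ≤ 2 * ‖w‖ ^ 2 + 2 * ‖ξ‖ ^ 2 * ‖v‖ ^ 2 := by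
  refine hasSum_le (fun m => ?_) ((hasSum_sum_norm_coeff_sq _).mul_left (R ^ 2))
    (((hasSum_sum_norm_coeff_sq w).mul_left 2).add
      ((hasSum_sum_norm_coeff_sq v).mul_left (2 * ‖ξ‖ ^ 2)))
  simp only [PiLp.sub_apply, map_sub, coeff_lowModes]
  have h3 : 0 ≤ ∑ i, ‖coeff b m (v i)‖ ^ 2 := by positivity
  split_ifs with hm
  · simp only [sub_self, norm_zero, ne_eq, OfNat.ofNat_ne_zero, not_false_eq_true, zero_pow,
      Finset.sum_const_zero, mul_zero]
    positivity
  · simp only [sub_zero]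
    rw [sum_norm_coeff_curl_sq hw hv m]
    have h4 := mul_le_mul_of_nonneg_right (norm_frequency_sq_le (ξ := ξ) (b := b) m) h3
    have h5 := mul_le_mul_of_nonneg_right (pow_le_pow_left₀ hR (hS m hm) 2) h3
    nlinarith [mul_nonneg (sq_nonneg β) h3]

theorem isClosed_divFree : IsClosed (divFree b ξ β : Set (L2Vec b)) := by
  have h : (divFree b ξ β : Set (L2Vec b)) =
      ⋂ m, {v | ∑ j, (modeVector b ξ β m j : ℂ) * coeff b m (v j) = 0} := by
    ext v
    rw [Set.mem_iInter]
    exact isDivFree_iff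
  rw [h]
  refine isClosed_iInter fun m => isClosed_eq ?_ continuous_const
  fun_prop

instance completeSpace_divFree : CompleteSpace (divFree b ξ β) :=
  isClosed_divFree.completeSpace_coe

/-- Every wave vector has a nonzero amplitude orthogonal to it, and the resulting divergence-free
plane waves of different indices are mutually orthogonal. -/
theorem not_finiteDimensional_divFree : ¬ FiniteDimensional ℂ (divFree b ξ β) := by
  intro hfin
  have hex : ∀ k : Fin 3 → ℝ, ∃ c : Fin 3 → ℂ, c ≠ 0 ∧ ∑ i, (k i : ℂ) * c i = 0 := by
    intro k
    by_cases h : k 0 = 0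
    · refine ⟨![1, 0, 0], fun h0 => ?_, ?_⟩
      · simpa using congrFun h0 0
      · simp [Fin.sum_univ_three, h]
    · refine ⟨![(k 1 : ℂ), -(k 0 : ℂ), 0], fun h0 => ?_, ?_⟩
      · exact h (by simpa using congrFun h0 1)
      · simp [Fin.sum_univ_three]
        ring
  choose c hc0 hc using hex
  let f : (Fin 2 → ℤ) → divFree b ξ β := fun m =>
    ⟨planeWave b m (c (modeVector b ξ β m)), isDivFree_planeWave (hc _)⟩
  have hinner : ∀ m l, inner ℂ (f m) (f l) =
      ∑ i, starRingEnd ℂ (c (modeVector b ξ β m) i) *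
        if m = l then c (modeVector b ξ β l) i else 0 := by
    intro m l
    have h := inner_planeWave (b := b) m (c (modeVector b ξ β m))
      (planeWave b l (c (modeVector b ξ β l)))
    simp only [coeff_planeWave] at h
    exact h
  have hli : LinearIndependent ℂ f := by
    refine linearIndependent_of_ne_zero_of_inner_eq_zero (fun m h0 => hc0 (modeVector b ξ β m) ?_)
      fun m l hml => ?_
    · ext i
      have h1 := coeff_planeWave (b := b) m m (c (modeVector b ξ β m)) i
      rw [if_pos rfl] at h1
      rw [← h1, show planeWave b m (c (modeVector b ξ β m)) = 0 from congrArg Subtype.val h0]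
      simp
    · change inner ℂ (f m) (f l) = 0
      rw [hinner]
      simp [hml]
  have := hli.finite
  exact not_finite (Fin 2 → ℤ)

end PlaneWaves

/-! ### The Maxwell operator as `A†A` with `A = n⁻¹ ∇' ×` -/

section Resolvent

variable {b : Module.Basis (Fin 2) ℝ Plane} {n : Plane → ℝ}

theorem IsIndex.mulOp_mulOp_inv (hn : IsIndex b n) (u : L2 b) :
    mulOp hn.memLp (mulOp hn.memLp_inv u) = u :=
  mulOp_mulOp_eq_self _ _ (hn.pos.mono fun _ hx => mul_inv_cancel₀ hx.ne') u

theorem IsIndex.mulOp_inv_mulOp (hn : IsIndex b n) (u : L2 b) :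
    mulOp hn.memLp_inv (mulOp hn.memLp u) = u :=
  mulOp_mulOp_eq_self _ _ (hn.pos.mono fun _ hx => inv_mul_cancel₀ hx.ne') u

/-- Componentwise application of an operator on `L²(Q')`. -/
def mapVec (A : L2 b →L[ℂ] L2 b) : L2Vec b →L[ℂ] L2Vec b :=
  (PiLp.continuousLinearEquiv 2 ℂ (fun _ : Fin 3 => L2 b)).symm ∘L
    ContinuousLinearMap.pi fun i => A ∘L PiLp.proj 2 (fun _ : Fin 3 => L2 b) i

/-- Multiplication by the index `n` in `𝕃²(Q')`. -/
def IsIndex.mulVec (hn : IsIndex b n) : L2Vec b →L[ℂ] L2Vec b := mapVec (mulOp hn.memLp)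

/-- Multiplication by `n⁻¹` in `𝕃²(Q')`. -/
def IsIndex.invVec (hn : IsIndex b n) : L2Vec b →L[ℂ] L2Vec b := mapVec (mulOp hn.memLp_inv)

theorem IsIndex.mulVec_invVec (hn : IsIndex b n) (v : L2Vec b) : hn.mulVec (hn.invVec v) = v := by
  ext1 i
  exact hn.mulOp_mulOp_inv (v i)

theorem IsIndex.invVec_mulVec (hn : IsIndex b n) (v : L2Vec b) : hn.invVec (hn.mulVec v) = v := by
  ext1 i
  exact hn.mulOp_inv_mulOp (v i)

theorem IsIndex.inner_invVec_left (hn : IsIndex b n) (u v : L2Vec b) :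
    inner ℂ (hn.invVec u) v = inner ℂ u (hn.invVec v) := by
  rw [PiLp.inner_apply, PiLp.inner_apply]
  exact Finset.sum_congr rfl fun i _ => inner_mulOp_left hn.memLp_inv (u i) (v i)

variable (ξ : Plane) (β : ℝ)

/-- The graph of `n⁻¹ ∇'_(ξ',β) × ·` as a subspace of a Hilbert space. -/
def energyGraph (hn : IsIndex b n) : Submodule ℂ (divFree b ξ β × L2Vec b) where
  carrier := {p | IsWeakCurl b ξ β (p.1 : L2Vec b) (hn.mulVec p.2)}
  zero_mem' := by
    have h := isWeakCurl_zero b ξ β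
    nth_rw 2 [← map_zero hn.mulVec] at h
    exact h
  add_mem' := fun {p q} hp hq => by
    have h := IsWeakCurl.add hp hq
    rw [← map_add] at h
    exact h
  smul_mem' := fun c p hp => by
    have h := IsWeakCurl.smul c hp
    rw [← map_smul] at h
    exact h

theorem mem_energyGraph {hn : IsIndex b n} {p : divFree b ξ β × L2Vec b} :
    p ∈ energyGraph ξ β hn ↔ IsWeakCurl b ξ β (p.1 : L2Vec b) (hn.mulVec p.2) := Iff.rfl

theorem isClosed_energyGraph (hn : IsIndex b n) :
    IsClosed (energyGraph ξ β hn : Set (divFree b ξ β × L2Vec b)) := by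
  have h : (energyGraph ξ β hn : Set (divFree b ξ β × L2Vec b)) =
      ⋂ (m) (i), {p | coeff b m (hn.mulVec p.2 i) = Complex.I *
        ((modeVector b ξ β m (i + 1) : ℂ) * coeff b m ((p.1 : L2Vec b) (i + 2)) -
          (modeVector b ξ β m (i + 2) : ℂ) * coeff b m ((p.1 : L2Vec b) (i + 1)))} := by
    ext p
    simp only [Set.mem_iInter]
    exact isWeakCurl_iff
  have h1 : Continuous fun p : divFree b ξ β × L2Vec b => (p.1 : L2Vec b) :=
    continuous_subtype_val.comp continuous_fst
  have h2 : Continuous fun p : divFree b ξ β × L2Vec b => p.2 :=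
    continuous_snd
  rw [h]
  refine isClosed_iInter fun m => isClosed_iInter fun i => isClosed_eq ?_ ?_
  · fun_prop
  · fun_prop

theorem norm_sub_lowModes_sq_le_of_mem {hn : IsIndex b n} {p : divFree b ξ β × L2Vec b}
    (hp : p ∈ energyGraph ξ β hn) {R : ℝ} (hR : 0 ≤ R) :
    R ^ 2 * ‖(p.1 : L2Vec b) -
        lowModes b (finite_setOf_norm_frequency_le b R).toFinset (p.1 : L2Vec b)‖ ^ 2 ≤
      (2 * ‖hn.mulVec‖ ^ 2 + 2 * ‖ξ‖ ^ 2) * (‖p.1‖ ^ 2 + ‖p.2‖ ^ 2) := by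
  have h1 := norm_sub_lowModes_sq_le ((mem_energyGraph ξ β).1 hp) p.1.2
    (S := (finite_setOf_norm_frequency_le b R).toFinset) hR fun m hm => by
      rw [Set.Finite.mem_toFinset] at hm
      exact (not_le.1 hm).le
  have h2 : ‖hn.mulVec p.2‖ ^ 2 ≤ ‖hn.mulVec‖ ^ 2 * ‖p.2‖ ^ 2 := by
    rw [← mul_pow]
    exact pow_le_pow_left₀ (norm_nonneg _) (hn.mulVec.le_opNorm _) 2
  refine h1.trans ?_
  change _ ≤ _ * (‖(p.1 : L2Vec b)‖ ^ 2 + _)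
  nlinarith [mul_nonneg (sq_nonneg ‖hn.mulVec‖) (sq_nonneg ‖(p.1 : L2Vec b)‖),
    mul_nonneg (sq_nonneg ‖ξ‖) (sq_nonneg ‖p.2‖)]

theorem planeWave_mem_energyGraph (hn : IsIndex b n) {m : Fin 2 → ℤ} {c : Fin 3 → ℂ}
    (hc : ∑ i, (modeVector b ξ β m i : ℂ) * c i = 0) :
    ((⟨planeWave b m c, isDivFree_planeWave hc⟩ : divFree b ξ β),
      hn.invVec (planeWave b m (iCross (modeVector b ξ β m) c))) ∈ energyGraph ξ β hn := by
  rw [mem_energyGraph]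
  change IsWeakCurl b ξ β (planeWave b m c) (hn.mulVec (hn.invVec _))
  rw [hn.mulVec_invVec]
  exact isWeakCurl_planeWave m c

theorem eq_zero_of_sum_conj_mul {c : Fin 3 → ℂ} (h : ∑ i, starRingEnd ℂ (c i) * c i = 0)
    (i : Fin 3) : c i = 0 := by
  have h1 : ((∑ i, ‖c i‖ ^ 2 : ℝ) : ℂ) = 0 := by
    rw [← h]
    push_cast
    exact Finset.sum_congr rfl fun i _ => (Complex.conj_mul' _).symm
  have h2 := (Finset.sum_eq_zero_iff_of_nonneg fun i _ => sq_nonneg ‖c i‖).1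
    (Complex.ofReal_eq_zero.1 h1) i (Finset.mem_univ i)
  exact norm_eq_zero.1 ((pow_eq_zero_iff two_ne_zero).1 h2)

/-- This is density of the domain of `A`. The coefficient of `x` at `m` is orthogonal to the wave
vector, so the plane wave carrying it lies in that domain; testing with it gives the squared norm of
the coefficient. -/
theorem eq_zero_of_inner_energyGraph (hn : IsIndex b n) (x : divFree b ξ β)
    (hx : ∀ p ∈ energyGraph ξ β hn, inner ℂ p.1 x = 0) : x = 0 := by
  refine Subtype.ext ?_
  ext1 i
  refine ext_coeff fun m => ?_
  set c : Fin 3 → ℂ := fun i => coeff b m ((x : L2Vec b) i) with hcdef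
  have hc : ∑ i, (modeVector b ξ β m i : ℂ) * c i = 0 := isDivFree_iff.1 x.2 m
  have h1 := hx _ (planeWave_mem_energyGraph ξ β hn hc)
  have h2 : inner ℂ (planeWave b m c) (x : L2Vec b) = 0 := h1
  rw [inner_planeWave] at h2
  have h3 : c i = 0 := eq_zero_of_sum_conj_mul h2 i
  rw [hcdef] at h3
  refine h3.trans ?_
  simp

/-- The vector `y` is `n⁻¹ ∇' × u`. Moving a factor `n⁻¹` across the inner product and using the
symmetry of the curl turns the strong equation into the weak one. The converse recovers the strong
equation one Fourier coefficient at a time. -/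
theorem mem_maxwellGraph_iff (hn : IsIndex b n) (u f : divFree b ξ β) :
    (u, f) ∈ maxwellGraph b n ξ β ↔ ∃ y, (u, y) ∈ energyGraph ξ β hn ∧
      ∀ q ∈ energyGraph ξ β hn, inner ℂ q.2 y = inner ℂ q.1 f := by
  constructor
  · rintro ⟨w, g, hw, hg, hf⟩
    have hg' : g = hn.invVec (hn.invVec w) := by
      ext1 i
      refine Lp.ext ?_
      filter_upwards [hg i, coeFn_mulOp hn.memLp_inv (hn.invVec w i),
        coeFn_mulOp hn.memLp_inv (w i)] with x h1 h2 h3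
      change _ = mulOp hn.memLp_inv (mulOp hn.memLp_inv (w i)) x
      change _ = ((n x)⁻¹ : ℝ) * mulOp hn.memLp_inv (w i) x at h2
      rw [h1]
      refine Eq.trans ?_ h2.symm
      rw [h3, ← mul_assoc, ← Complex.ofReal_mul]
      congr 2
      ring
    refine ⟨hn.invVec w, ?_, fun q hq => ?_⟩
    · rw [mem_energyGraph]
      change IsWeakCurl b ξ β u (hn.mulVec (hn.invVec w))
      rw [hn.mulVec_invVec]
      exact hw
    · have h1 : inner ℂ q.2 (hn.invVec w) = inner ℂ (hn.mulVec q.2) g := by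
        rw [hg', ← hn.inner_invVec_left (hn.mulVec q.2), hn.invVec_mulVec]
      rw [h1, inner_curl_left ((mem_energyGraph ξ β).1 hq) hf]
      rfl
  · rintro ⟨y, hy, hq⟩
    refine ⟨hn.mulVec y, hn.invVec y, hy, fun i => ?_, ?_⟩
    · filter_upwards [coeFn_mulOp hn.memLp_inv (y i), coeFn_mulOp hn.memLp (y i), hn.pos]
        with x h1 h2 h3
      change mulOp hn.memLp_inv (y i) x = _ * mulOp hn.memLp (y i) x
      have h4 : (n x : ℂ) ≠ 0 := Complex.ofReal_ne_zero.2 h3.ne'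
      rw [h1, h2]
      push_cast
      field_simp
    · rw [isWeakCurl_iff]
      intro m
      set k := modeVector b ξ β m
      set g : Fin 3 → ℂ := fun i => coeff b m (hn.invVec y i)
      -- The defect of the equation at mode `m`. Both of its terms are orthogonal to `k`, the second
      -- because `f` is divergence-free, so the defect is itself an admissible amplitude; testing
      -- with it shows that its norm vanishes.
      set c : Fin 3 → ℂ := fun i => iCross k g i - coeff b m ((f : L2Vec b) i) with hcdef
      have hc : ∑ i, (k i : ℂ) * c i = 0 := by
        simp only [hcdef, mul_sub]
        rw [Finset.sum_sub_distrib, sum_mul_iCross, isDivFree_iff.1 f.2 m, sub_zero]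
      have h1 := hq _ (planeWave_mem_energyGraph ξ β hn hc)
      have h2 : inner ℂ (hn.invVec (planeWave b m (iCross k c))) y =
        inner ℂ (planeWave b m c) (f : L2Vec b) := h1
      rw [hn.inner_invVec_left, inner_planeWave, inner_planeWave, sum_conj_iCross_mul] at h2
      have h3 : ∑ i, starRingEnd ℂ (c i) * c i = 0 := by
        rw [← sub_eq_zero.2 h2, ← Finset.sum_sub_distrib]
        exact Finset.sum_congr rfl fun i _ => mul_sub _ _ _
      intro i
      exact (sub_eq_zero.1 (eq_zero_of_sum_conj_mul h3 i)).symm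

end Resolvent

end PhotonicCrystal

end

/-! ### The theorem -/

theorem mainTheorem6 (b : Module.Basis (Fin 2) ℝ PhotonicCrystal.Plane)
    (ε₀ : ℝ) (hε₀ : 0 < ε₀) (ε : PhotonicCrystal.Plane → ℝ)
    (hper : ∀ k ∈ PhotonicCrystal.lattice b, ∀ᵐ x, ε (x + k) = ε x)
    (hpos : ∀ᵐ x, 0 < ε x)
    (hbdd : MemLp ε ⊤ volume)
    (hbdd_inv : MemLp (fun x => (ε x)⁻¹) ⊤ volume)
    (n : PhotonicCrystal.Plane → ℝ) (hn : n = PhotonicCrystal.refractiveIndex ε₀ ε)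
    (β : ℝ) (ξ : PhotonicCrystal.Plane) (hξ : ξ ∈ PhotonicCrystal.brillouinZone b) :
    PhotonicCrystal.variationalSpace b ξ β ≤ PhotonicCrystal.sobolevH1 b ∧
    (∀ v ∈ PhotonicCrystal.variationalSpace b ξ β,
      (PhotonicCrystal.form b n ξ β v v).im = 0 ∧
      (1 / 2) * PhotonicCrystal.h1Norm b v ^ 2 + β ^ 2 * ‖v‖ ^ 2 ≤
        PhotonicCrystal.indexSupNorm b n ^ 2 * (PhotonicCrystal.form b n ξ β v v).re +
          (3 * ‖ξ‖ ^ 2 + 1) * ‖v‖ ^ 2) ∧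
    ∃ eig : ℕ → ℝ,
      StrictMono eig ∧ (∀ m, 0 ≤ eig m) ∧ Tendsto eig atTop atTop ∧
      PhotonicCrystal.unboundedSpectrum (PhotonicCrystal.maxwellOperator b n ξ β) =
        Set.range (fun m => (eig m : ℂ)) ∧
      ∀ m,
        PhotonicCrystal.unboundedEigenspace
          (PhotonicCrystal.maxwellOperator b n ξ β) (eig m : ℂ) ≠ ⊥ ∧
        FiniteDimensional ℂ (PhotonicCrystal.unboundedEigenspace
          (PhotonicCrystal.maxwellOperator b n ξ β) (eig m : ℂ)) := by
  have hidx : PhotonicCrystal.IsIndex b n :=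
    hn ▸ PhotonicCrystal.isIndex_refractiveIndex b hε₀ hpos hbdd hbdd_inv
  refine ⟨PhotonicCrystal.variationalSpace_le_sobolevH1, fun v hv => ⟨?_, ?_⟩, ?_⟩
  · rw [PhotonicCrystal.form_self, Complex.ofReal_im]
  · exact (PhotonicCrystal.h1Norm_sq_le (PhotonicCrystal.isWeakCurl_curl hv.1) hv.2).trans
      (add_le_add_left (PhotonicCrystal.norm_curl_sq_le_form hidx v) _)
  · refine PhotonicCrystal.exists_eigenvalues_of_graph
      (PhotonicCrystal.isClosed_energyGraph ξ β hidx)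
      PhotonicCrystal.not_finiteDimensional_divFree
      (PhotonicCrystal.divFree b ξ β).subtypeₗᵢ
      -- Cutting off at `k + 1` gives the factor `(k + 1)²` demanded by the abstract criterion.
      (fun k => PhotonicCrystal.isCompactOperator_lowModes
        (PhotonicCrystal.finite_setOf_norm_frequency_le b ((k : ℝ) + 1)).toFinset)
      (C := 2 * ‖hidx.mulVec‖ ^ 2 + 2 * ‖ξ‖ ^ 2) (by positivity)
      (fun k p hp => PhotonicCrystal.norm_sub_lowModes_sq_le_of_mem ξ β hp (by positivity))
      (PhotonicCrystal.eq_zero_of_inner_energyGraph ξ β hidx) _ fun u f => ?_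
    rw [PhotonicCrystal.maxwellOperator_graph]
    exact PhotonicCrystal.mem_maxwellGraph_iff ξ β hidx u f
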